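/- Let $M=\mathbb H^n/\Gamma$ be a (complete) hyperbolic $n$-manifold, where $\Gamma$ acts on $\mathbb H^n$ freely, properly discontinuously and by isometries. A \emph{carrier graph} in $M$ is a continuous map $f:X\to M$ from a connected finite graph $X$ (loops and multiple edges are allowed) that is surjective on $\pi_1$. Its length is the sum of the hyperbolic lengths of the images of the edges of $X$. An \emph{edge move} on $f$ produces a map of graphs $g:Y\to M$ as follows. Pick an edge $e$ of $X$ with endpoints $v_0,v_1$ and a path $\alpha$ in $X\setminus e$ (i.e. $\alpha$ does not cross the interior of $e$) from $v_1$ to some point $w$; if $w$ is in the interior of an edge, make it a new vertex. Detach $e$ from $v_1$ and attach this end to $w$; this gives the graph $Y$. Let $g=f$ off $e$, and let $g$ map $e$ to a path from $f(v_0)$ to $f(w)$ homotopic to $f(e)\cdot f(\alpha)$ rel endpoints. Finally change $g$ by a homotopy that fixes all vertices of $Y$, except possibly $w$ if $w$ is a new vertex. Here, if an edge is a loop, one may first cut it into two edges by inserting a vertex in its interior (so that one end of a loop can be dragged along the other part of the loop). The carrier graph $f$ has \emph{minimal length rel vertices} if no edge move on $f$ decreases the length. \textbf{Proposition.} Let $f:X\to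 M$ be a carrier graph with minimal length rel vertices in a hyperbolic $n$-manifold $M$. Then: (1) at every vertex of $X$ there are at most three ends of edges that are not mapped to a point; in particular, if no edge of $X$ is mapped to a point, then $X$ is at most trivalent; (2) each edge of $X$ is mapped (monotonically) to a geodesic segment in $M$, possibly degenerate to a point; (3) if two different ends of edges, belonging to edges that are not mapped to a point (possibly to the same edge, if it is a loop), are attached to the same vertex, then their images make an angle of at least $2\pi/3$ there; (4) every simple closed edge path in $X$ is mapped either to a point or to an essential (homotopically nontrivial) loop in $M$. -/

import Mathlib

open scoped unitInterval ENNReal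

noncomputable section

/-! ### Hyperbolic space: the hyperboloid model -/

/-- The Lorentzian form of signature `(n, 1)` on `ℝ × ℝⁿ`. -/
def mink {n : ℕ} (v w : ℝ × EuclideanSpace ℝ (Fin n)) : ℝ :=
  inner ℝ v.2 w.2 - v.1 * w.1

/-- Hyperbolic `n`-space: the upper sheet of the hyperboloid `⟨v, v⟩ = -1` in `ℝ^{n,1}`. -/
@[ext]
structure HypSpace (n : ℕ) where
  vec : ℝ × EuclideanSpace ℝ (Fin n)
  pos : 0 < vec.1
  eq_neg_one : mink vec vec = -1

namespace HypSpace

variable {n : ℕ}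

theorem mink_comm (v w : ℝ × EuclideanSpace ℝ (Fin n)) : mink v w = mink w v := by
  simp only [mink, real_inner_comm, mul_comm]

theorem mink_add_left (u v w : ℝ × EuclideanSpace ℝ (Fin n)) :
    mink (u + v) w = mink u w + mink v w := by
  simp only [mink, Prod.fst_add, Prod.snd_add, inner_add_left]; ring

theorem mink_smul_left (c : ℝ) (v w : ℝ × EuclideanSpace ℝ (Fin n)) :
    mink (c • v) w = c * mink v w := by
  simp only [mink, Prod.smul_fst, Prod.smul_snd, real_inner_smul_left, smul_eq_mul]; ring

theorem mink_add_right (u v w : ℝ × EuclideanSpace ℝ (Fin n)) :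
    mink u (v + w) = mink u v + mink u w := by
  rw [mink_comm, mink_add_left, mink_comm v, mink_comm w]

theorem mink_smul_right (c : ℝ) (v w : ℝ × EuclideanSpace ℝ (Fin n)) :
    mink v (c • w) = c * mink v w := by
  rw [mink_comm, mink_smul_left, mink_comm]

/-- The form is positive definite on the orthogonal complement of a point of `ℍⁿ`. -/
theorem norm_sq_le_of_orthogonal (y : HypSpace n) (w : ℝ × EuclideanSpace ℝ (Fin n))
    (h : mink w y.vec = 0) : ‖w.2‖ ^ 2 ≤ y.vec.1 ^ 2 * mink w w := by
  have hy := y.eq_neg_one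
  simp only [mink, real_inner_self_eq_norm_sq] at hy h ⊢
  have hcs : (inner ℝ w.2 y.vec.2 : ℝ) ^ 2 ≤ (‖w.2‖ * ‖y.vec.2‖) ^ 2 :=
    sq_le_sq' (by linarith [neg_le_of_abs_le (abs_real_inner_le_norm w.2 y.vec.2)])
      (real_inner_le_norm _ _)
  have h1 : (inner ℝ w.2 y.vec.2 : ℝ) = w.1 * y.vec.1 := by linarith
  rw [h1] at hcs
  have h2 : ‖y.vec.2‖ ^ 2 = y.vec.1 * y.vec.1 - 1 := by linarith
  rw [mul_pow ‖w.2‖, h2] at hcs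
  nlinarith

theorem mink_self_nonneg (y : HypSpace n) (w : ℝ × EuclideanSpace ℝ (Fin n))
    (h : mink w y.vec = 0) : 0 ≤ mink w w := by
  have h1 := norm_sq_le_of_orthogonal y w h
  have h2 : 0 < y.vec.1 ^ 2 := pow_pos y.pos 2
  by_contra hc
  nlinarith [sq_nonneg ‖w.2‖, mul_pos_of_neg_of_neg (not_le.1 hc) (neg_lt_zero.2 h2)]

theorem mink_cauchy_schwarz (y : HypSpace n) (u v : ℝ × EuclideanSpace ℝ (Fin n))
    (hu : mink u y.vec = 0) (hv : mink v y.vec = 0) :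
    mink u v ^ 2 ≤ mink u u * mink v v := by
  have key : ∀ s : ℝ, 0 ≤ mink v v * (s * s) + (2 * mink u v) * s + mink u u := by
    intro s
    have h := mink_self_nonneg y (u + s • v) (by
      rw [mink_add_left, mink_smul_left, hu, hv]; ring)
    simp only [mink_add_left, mink_add_right, mink_smul_left, mink_smul_right] at h
    rw [mink_comm v u] at h
    linarith
  have := discrim_le_zero key
  rw [discrim] at this
  nlinarith

/-- The component of `x` orthogonal to `y`. -/
theorem mink_proj (x y : HypSpace n) : mink (x.vec + mink x.vec y.vec • y.vec) y.vec = 0 := by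
  rw [mink_add_left, mink_smul_left, y.eq_neg_one]; ring

theorem one_le_neg_mink (x y : HypSpace n) : 1 ≤ -mink x.vec y.vec := by
  have h := mink_self_nonneg y _ (mink_proj x y)
  simp only [mink_add_left, mink_add_right, mink_smul_left, mink_smul_right, x.eq_neg_one,
    y.eq_neg_one, mink_comm y.vec x.vec] at h
  have hneg : mink x.vec y.vec < 0 := by
    have hx := x.eq_neg_one
    have hy := y.eq_neg_one
    simp only [mink, real_inner_self_eq_norm_sq] at hx hy ⊢
    have h1 : ‖x.vec.2‖ < x.vec.1 := lt_of_pow_lt_pow_left₀ 2 x.pos.le (by nlinarith)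
    have h2 : ‖y.vec.2‖ < y.vec.1 := lt_of_pow_lt_pow_left₀ 2 y.pos.le (by nlinarith)
    have h3 := real_inner_le_norm x.vec.2 y.vec.2
    have h4 : ‖x.vec.2‖ * ‖y.vec.2‖ < x.vec.1 * y.vec.1 :=
      mul_lt_mul'' h1 h2 (norm_nonneg _) (norm_nonneg _)
    linarith
  nlinarith

/-- The hyperbolic metric: `cosh (dist x y) = -⟨x, y⟩`. -/
instance : Dist (HypSpace n) := ⟨fun x y => Real.arcosh (-mink x.vec y.vec)⟩

theorem dist_def (x y : HypSpace n) : dist x y = Real.arcosh (-mink x.vec y.vec) := rfl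

theorem cosh_dist (x y : HypSpace n) : Real.cosh (dist x y) = -mink x.vec y.vec :=
  Real.cosh_arcosh (one_le_neg_mink x y)

theorem dist_nonneg' (x y : HypSpace n) : 0 ≤ dist x y :=
  Real.arcosh_nonneg (one_le_neg_mink x y)

theorem dist_triangle' (x y z : HypSpace n) : dist x z ≤ dist x y + dist y z := by
  have h0 : 0 ≤ dist x y + dist y z := add_nonneg (dist_nonneg' x y) (dist_nonneg' y z)
  rw [← abs_of_nonneg (dist_nonneg' x z), ← abs_of_nonneg h0, ← Real.cosh_le_cosh,
    Real.cosh_add, cosh_dist, cosh_dist, cosh_dist]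
  have hA := one_le_neg_mink x y
  have hB := one_le_neg_mink y z
  have hcs := mink_cauchy_schwarz y _ _ (mink_proj x y) (mink_proj z y)
  simp only [mink_add_left, mink_add_right, mink_smul_left, mink_smul_right, x.eq_neg_one,
    y.eq_neg_one, z.eq_neg_one, mink_comm y.vec x.vec, mink_comm z.vec y.vec] at hcs
  have hs1 : Real.sinh (dist x y) ^ 2 = mink x.vec y.vec ^ 2 - 1 := by
    rw [Real.sinh_sq, cosh_dist]; ring
  have hs2 : Real.sinh (dist y z) ^ 2 = mink y.vec z.vec ^ 2 - 1 := by
    rw [Real.sinh_sq, cosh_dist]; ring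
  have hs : 0 ≤ Real.sinh (dist x y) * Real.sinh (dist y z) :=
    mul_nonneg (Real.sinh_nonneg_iff.2 (dist_nonneg' x y))
      (Real.sinh_nonneg_iff.2 (dist_nonneg' y z))
  have := abs_le_of_sq_le_sq' (a := mink x.vec z.vec + mink x.vec y.vec * mink y.vec z.vec)
    (b := Real.sinh (dist x y) * Real.sinh (dist y z))
    (by rw [mul_pow, hs1, hs2]; linarith) hs
  linarith [this.1]

theorem eq_of_dist_eq_zero' (x y : HypSpace n) (h : dist x y = 0) : x = y := by
  have h1 := cosh_dist x y
  rw [h, Real.cosh_zero] at h1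
  have hxy : mink x.vec y.vec = -1 := by linarith
  have hp := mink_proj x y
  have hn := norm_sq_le_of_orthogonal y _ hp
  have h0 : mink (x.vec + mink x.vec y.vec • y.vec) (x.vec + mink x.vec y.vec • y.vec) = 0 := by
    simp only [mink_add_left, mink_add_right, mink_smul_left, mink_smul_right, x.eq_neg_one,
      y.eq_neg_one, mink_comm y.vec x.vec, hxy]
    ring
  rw [h0, mul_zero, hxy] at hn
  have h2 : (x.vec + (-1 : ℝ) • y.vec).2 = 0 := by
    rw [← norm_eq_zero]; exact pow_eq_zero_iff two_ne_zero |>.1 (le_antisymm hn (sq_nonneg _))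
  rw [hxy] at hp
  have h3 : (x.vec + (-1 : ℝ) • y.vec).1 = 0 := by
    rw [mink, h2, inner_zero_left, zero_sub, neg_eq_zero, mul_eq_zero] at hp
    exact hp.resolve_right y.pos.ne'
  have h4 : x.vec + (-1 : ℝ) • y.vec = 0 := Prod.ext h3 h2
  apply HypSpace.ext
  rw [neg_one_smul, ← sub_eq_add_neg] at h4
  exact sub_eq_zero.1 h4

instance : MetricSpace (HypSpace n) where
  dist_self x := by rw [dist_def, x.eq_neg_one, neg_neg, Real.arcosh_zero]
  dist_comm x y := by rw [dist_def, dist_def, mink_comm]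
  dist_triangle := dist_triangle'
  eq_of_dist_eq_zero {x y} := eq_of_dist_eq_zero' x y

/-- The tangent vector at `x` pointing along the geodesic segment from `x` to `p`
(a positive multiple of its initial velocity if `p ≠ x`). -/
def direction (x p : HypSpace n) : ℝ × EuclideanSpace ℝ (Fin n) :=
  p.vec + mink x.vec p.vec • x.vec

/-- The angle at `x` between the geodesic segments `[x, p]` and `[x, q]`, for `p, q ≠ x`,
measured in the Riemannian metric (the restriction of `mink` to the tangent space at `x`). -/
def angle (x p q : HypSpace n) : ℝ :=
  Real.arccos (mink (direction x p) (direction x q) /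
    (Real.sqrt (mink (direction x p) (direction x p)) *
      Real.sqrt (mink (direction x q) (direction x q))))

end HypSpace

/-! ### Hyperbolic manifolds `ℍⁿ / Γ`, lengths and geodesics -/

/-- The quotient `ℍⁿ / Γ` with the quotient topology. -/
abbrev HypQuotient (n : ℕ) (Γ : Type*) [Group Γ] [MulAction Γ (HypSpace n)] : Type :=
  MulAction.orbitRel.Quotient Γ (HypSpace n)

section Quotient

variable {n : ℕ} {Γ : Type*} [Group Γ] [MulAction Γ (HypSpace n)]

/-- `p` is a lift of the path `γ` in `ℍⁿ / Γ` to the universal cover `ℍⁿ`. -/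
def IsLift (p : C(I, HypSpace n)) (γ : I → HypQuotient n Γ) : Prop :=
  ∀ t, (Quotient.mk _ (p t) : HypQuotient n Γ) = γ t

/-- The hyperbolic length of a path in `ℍⁿ / Γ`: the length of a lift to `ℍⁿ`. (When `Γ` acts
freely, properly discontinuously and isometrically, lifts exist and all have the same length.) -/
def pathLength (γ : I → HypQuotient n Γ) : ℝ≥0∞ :=
  ⨅ (p : C(I, HypSpace n)) (_ : IsLift p γ), eVariationOn p Set.univ

/-- `γ` runs monotonically along a (possibly degenerate) geodesic segment in `ℍⁿ / Γ`, i.e. along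
the image of a unit speed geodesic `c : [0, L] → ℍⁿ`. -/
def IsGeodesicSegment (γ : I → HypQuotient n Γ) : Prop :=
  ∃ (L : ℝ) (c : ℝ → HypSpace n) (φ : C(I, ℝ)), 0 ≤ L ∧
    (∀ s ∈ Set.Icc 0 L, ∀ t ∈ Set.Icc 0 L, dist (c s) (c t) = |s - t|) ∧
    Monotone φ ∧ φ 0 = 0 ∧ φ 1 = L ∧
    ∀ t, γ t = Quotient.mk _ (c (φ t))

end Quotient

/-! ### Graphs, their realizations, and maps of graphs -/

/-- A graph (one-dimensional cell complex); loops and multiple edges are allowed. The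
orientation of the edges is only a bookkeeping device. -/
structure MGraph where
  V : Type*
  E : Type*
  src : E → V
  tgt : E → V

namespace MGraph

variable (X : MGraph)

/-- The oriented edges of `X`; they correspond to the ends of edges. -/
abbrev Dart : Type _ := X.E × Bool

variable {X} in
/-- The initial vertex of an oriented edge. -/
def init : X.Dart → X.V
  | (e, true) => X.src e
  | (e, false) => X.tgt e

variable {X} in
/-- The terminal vertex of an oriented edge. -/
def term : X.Dart → X.V
  | (e, true) => X.tgt e
  | (e, false) => X.src e

/-- Edge paths from `u` to `v`. -/
inductive Walk : X.V → X.V → Type _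
  | nil (v : X.V) : Walk v v
  | cons {u v : X.V} (d : X.Dart) (h : X.init d = u) (p : Walk (X.term d) v) : Walk u v

namespace Walk

variable {X}

/-- The edges traversed by an edge path. -/
def edges : {u v : X.V} → X.Walk u v → List X.E
  | _, _, nil _ => []
  | _, _, cons d _ p => d.1 :: p.edges

/-- The vertices visited by an edge path, without its final one. -/
def starts : {u v : X.V} → X.Walk u v → List X.V
  | _, _, nil _ => []
  | _, _, cons d _ p => X.init d :: p.starts

/-- A simple closed path: no vertex and no edge is visited twice. -/
def IsSimpleClosed {v : X.V} (p : X.Walk v v) : Prop :=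
  p.edges ≠ [] ∧ p.edges.Nodup ∧ p.starts.Nodup

end Walk

/-- The vertices and closed edges out of which the realization is glued. -/
abbrev Cells : Type _ := (Σ _ : X.V, PUnit.{1}) ⊕ (Σ _ : X.E, I)

/-- Endpoints of edges are glued to vertices. -/
inductive Glue : X.Cells → X.Cells → Prop
  | src (e : X.E) : Glue (Sum.inr ⟨e, 0⟩) (Sum.inl ⟨X.src e, PUnit.unit⟩)
  | tgt (e : X.E) : Glue (Sum.inr ⟨e, 1⟩) (Sum.inl ⟨X.tgt e, PUnit.unit⟩)

/-- The topological realization of `X`, with the quotient topology. -/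
abbrev Realization : Type _ := Quot X.Glue

/-- The same graph with all edges oriented the other way. -/
def reverse : MGraph where
  V := X.V
  E := X.E
  src := X.tgt
  tgt := X.src

open Classical in
/-- Insert a vertex `none` in the interior of the edge `a`: the edge `some a` becomes the part of
`a` from its source to the new vertex, and `none` the part from the new vertex to its target. -/
def subdivide (a : X.E) : MGraph where
  V := Option X.V
  E := Option X.E
  src
    | none => none
    | some e => some (X.src e)
  tgt
    | none => some (X.tgt a)
    | some e => if e = a then none else some (X.tgt e)

open Classical in
/-- Sever the attachment of `e` to its target and reattach this end of `e` to `w`. -/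
def retarget (e : X.E) (w : X.V) : MGraph where
  V := X.V
  E := X.E
  src := X.src
  tgt e' := if e' = e then w else X.tgt e'

end MGraph

/-- A (continuous) map of a graph to `M`, given by the images of the vertices and the paths that are
the restrictions to the edges. -/
structure GraphMap (X : MGraph) (M : Type*) [TopologicalSpace M] where
  vert : X.V → M
  edge : (e : X.E) → Path (vert (X.src e)) (vert (X.tgt e))

namespace GraphMap

variable {X : MGraph} {M : Type*} [TopologicalSpace M]

/-- The map as a continuous map on the topological realization of the graph. -/
def toMap (f : GraphMap X M) : C(X.Realization, M) where
  toFun := Quot.lift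
    (Sum.elim (fun v : (Σ _ : X.V, PUnit.{1}) => f.vert v.1)
      (fun p : (Σ _ : X.E, I) => f.edge p.1 p.2))
    (by
      rintro _ _ (e | e)
      · exact (f.edge e).source
      · exact (f.edge e).target)
  continuous_toFun := continuous_quot_lift _ (Continuous.sumElim
    (continuous_sigma fun v =>
      (continuous_const : Continuous fun _ : PUnit.{1} => f.vert v))
    (continuous_sigma fun e => (f.edge e).continuous))

/-- A carrier graph: the graph is connected and the map is surjective on `π₁`. -/
def IsCarrier (f : GraphMap X M) : Prop :=
  ConnectedSpace X.Realization ∧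
    ∀ x : X.Realization, Function.Surjective (FundamentalGroup.map f.toMap x)

/-- The restriction of the map to an oriented edge. -/
def dartPath (f : GraphMap X M) : (d : X.Dart) → Path (f.vert (X.init d)) (f.vert (X.term d))
  | (e, true) => f.edge e
  | (e, false) => (f.edge e).symm

/-- The image of an edge path. -/
def walkPath (f : GraphMap X M) : {u v : X.V} → X.Walk u v → Path (f.vert u) (f.vert v)
  | _, _, .nil v => Path.refl (f.vert v)
  | _, _, .cons d h p => ((f.dartPath d).trans (f.walkPath p)).cast (congrArg f.vert h.symm) rfl

/-- The same map, with all edges oriented the other way. -/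
def reverse (f : GraphMap X M) : GraphMap X.reverse M where
  vert := f.vert
  edge e := (f.edge e).symm

open Classical in
/-- The same map, with an extra vertex at the point `t` of the edge `a`. -/
def subdivide (f : GraphMap X M) (a : X.E) (t : I) : GraphMap (X.subdivide a) M where
  vert
    | none => f.edge a t
    | some v => f.vert v
  edge
    | none => ((f.edge a).subpath t 1).cast rfl (f.edge a).target.symm
    | some e =>
      if h : e = a then
        ((f.edge a).subpath 0 t).cast (by subst h; exact (f.edge e).source.symm)
          (by simp [MGraph.subdivide, h])
      else (f.edge e).cast rfl (by simp [MGraph.subdivide, h])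

open Classical in
/-- Reattach the terminal end of `e` to `w` and map `e` to the path `f(e) · f(α)`. -/
def slide (f : GraphMap X M) (e : X.E) {w : X.V} (α : X.Walk (X.tgt e) w) :
    GraphMap (X.retarget e w) M where
  vert := f.vert
  edge := fun (e' : X.E) =>
    if h : e' = e then
      ((f.edge e).trans (f.walkPath α)).cast (congrArg (fun x => f.vert (X.src x)) h)
        (congrArg f.vert (if_pos h))
    else (f.edge e').cast rfl (congrArg f.vert (if_neg h))

/-- `f` and `g` are homotopic by a homotopy that does not move the vertices in `S`. Here `τ v` is
the track of the vertex `v` and `H e` is the homotopy on the edge `e`. -/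
def HomotopicFixing (f g : GraphMap X M) (S : Set X.V) : Prop :=
  ∃ (τ : X.V → C(I, M)) (H : X.E → C(I × I, M)),
    (∀ v, τ v 0 = f.vert v ∧ τ v 1 = g.vert v) ∧
    (∀ v ∈ S, ∀ s, τ v s = f.vert v) ∧
    ∀ e, (∀ t, H e (0, t) = f.edge e t ∧ H e (1, t) = g.edge e t) ∧
      ∀ s, H e (s, 0) = τ (X.src e) s ∧ H e (s, 1) = τ (X.tgt e) s

/-- `f'` is obtained from `f` by inserting vertices in loops (edges both of whose ends are attached
to the same vertex) and by changing the bookkeeping orientation. -/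
inductive IsLoopRefinement (f : GraphMap X M) : (X' : MGraph) → GraphMap X' M → Prop
  | refl : IsLoopRefinement f X f
  | reverse {X' : MGraph} {f' : GraphMap X' M} (h : IsLoopRefinement f X' f') :
      IsLoopRefinement f X'.reverse f'.reverse
  | subdivide {X' : MGraph} {f' : GraphMap X' M} (h : IsLoopRefinement f X' f')
      (a : X'.E) (ha : X'.src a = X'.tgt a) (t : I) (ht : t ∈ Set.Ioo 0 1) :
      IsLoopRefinement f (X'.subdivide a) (f'.subdivide a t)

/-- `g` is the result of an edge move on `f`: the terminal end of an edge `e` is dragged along a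
path `α` that avoids `e` to a point `w`, which is either a vertex or an interior point of another
edge `b`; in the latter case `w` becomes a new vertex. Then the map is homotoped, fixing all
vertices except the new one. If `e` is a loop, it may be cut into two edges first. -/
inductive IsEdgeMove (f : GraphMap X M) : (Y : MGraph) → GraphMap Y M → Prop
  | toVertex {X' : MGraph} {f' : GraphMap X' M} (hf' : f.IsLoopRefinement X' f')
      (e : X'.E) (w : X'.V) (α : X'.Walk (X'.tgt e) w) (hα : e ∉ α.edges)
      (g : GraphMap (X'.retarget e w) M)
      (hg : (f'.slide e α).HomotopicFixing g Set.univ) :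
      IsEdgeMove f (X'.retarget e w) g
  | toInterior {X' : MGraph} {f' : GraphMap X' M} (hf' : f.IsLoopRefinement X' f')
      (e b : X'.E) (hb : b ≠ e) (t : I) (ht : t ∈ Set.Ioo 0 1)
      (α : (X'.subdivide b).Walk ((X'.subdivide b).tgt (some e)) none)
      (hα : some e ∉ α.edges)
      (g : GraphMap ((X'.subdivide b).retarget (some e) none) M)
      (hg : ((f'.subdivide b t).slide (some e) α).HomotopicFixing g {v | v ≠ none}) :
      IsEdgeMove f ((X'.subdivide b).retarget (some e) none) g

/-- The map sends the whole edge `e` to a point. -/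
def Collapses (f : GraphMap X M) (e : X.E) : Prop :=
  ∀ t, f.edge e t = f.vert (X.src e)

end GraphMap

section Length

variable {n : ℕ} {Γ : Type*} [Group Γ] [MulAction Γ (HypSpace n)]

/-- The total length of a graph in `ℍⁿ / Γ`: the sum of the lengths of its edges. -/
def GraphMap.length {X : MGraph} (f : GraphMap X (HypQuotient n Γ)) : ℝ≥0∞ :=
  ∑' e, pathLength (f.edge e)

/-- `f` has minimal length rel vertices: it does not admit a length-decreasing edge move. -/
def GraphMap.IsMinimalRelVertices {X : MGraph} (f : GraphMap X (HypQuotient n Γ)) : Prop :=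
  ∀ (Y : MGraph) (g : GraphMap Y (HypQuotient n Γ)), f.IsEdgeMove Y g → ¬ g.length < f.length

end Length

end

/-! Each assertion is proved by exhibiting an edge move that would shorten the graph. Everything is
measured in the universal cover: lifts of a path are unique up to `Γ`, so a path has a well-defined
length, at least the distance between the endpoints of a lift. Tightening all edges to the segments
between those endpoints is a homotopy that fixes the vertices (`exists_straighten`), and it may
follow any slide.

Edges: sliding along the constant path is an edge move, so no edge of a minimal graph is longer than
its tightened version (`length_ne_top_and_le`); it is therefore a geodesic segment.

Cycles: let a null-homotopic simple closed path contain an edge `e` that is not collapsed. The rest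
of the path avoids `e`, and dragging one end of `e` along it turns `e` into a loop with closed
lifts, which tightens to a point. The length drops by that of `e` (`not_homotopic_refl`).

Angles: let two segments leave `v` at an angle `θ < 2π/3`. When a point `w` leaves `v` with unit
speed along the bisector, the length of the tripod on `v` and the two far endpoints changes at the
rate `1 - 2 cos (θ/2) < 0` (`exists_shorter_tripod`). The tripod is the result of an edge move:
slide the end of one edge to an interior point of the other and move the new vertex to `w`
(`length_le_of_tripod`). If both ends belong to one loop, the loop is first cut in two
(`angle_of_loop`).

Valence: `k` unit vectors with pairwise products at most `-1/2` satisfy `0 ≤ |∑ u|² ≤ k (3 - k) /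
2`, so `k ≤ 3` (`card_le_three_of_angle`). -/

namespace HypSpace

open Filter Topology

variable {n : ℕ}

/-! ### Topology of the hyperboloid -/

theorem continuous_mink :
    Continuous fun p : (ℝ × EuclideanSpace ℝ (Fin n)) × (ℝ × EuclideanSpace ℝ (Fin n)) =>
      mink p.1 p.2 := by
  unfold mink
  fun_prop

theorem continuous_of_continuous_vec {T : Type*} [TopologicalSpace T] {g : T → HypSpace n}
    (h : Continuous fun t => (g t).vec) : Continuous g := by
  refine continuous_iff_continuousAt.2 fun t₀ => tendsto_iff_dist_tendsto_zero.2 ?_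
  have hc : Continuous fun t => dist (g t) (g t₀) := by
    simp only [dist_def]
    exact Real.continuousOn_arcosh.comp_continuous
      (continuous_mink.comp (h.prodMk continuous_const)).neg (fun t => one_le_neg_mink _ _)
  simpa using hc.tendsto t₀

/-- The topology is that of the hyperbolic metric, so this needs an estimate. Write `x = w + cosh d
• y` with `w` orthogonal to `y` and `d = dist x y`. Then `⟨w, w⟩ = sinh² d`, and positivity of the
form on the complement of `y` bounds the Euclidean size of `w`. -/
theorem continuous_vec : Continuous (vec : HypSpace n → _) := by
  refine continuous_iff_continuousAt.2 fun y => ?_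
  set w : HypSpace n → ℝ × EuclideanSpace ℝ (Fin n) :=
    fun x => x.vec + mink x.vec y.vec • y.vec with hw
  have hd : Tendsto (fun x : HypSpace n => dist x y) (𝓝 y) (𝓝 0) := by
    simpa using (continuous_id.dist (continuous_const (y := y))).tendsto y
  have h2 : Tendsto (fun x => (w x).2) (𝓝 y) (𝓝 0) := by
    refine squeeze_zero_norm (a := fun x => y.vec.1 * Real.sinh (dist x y)) (fun x => ?_) ?_
    · refine le_of_sq_le_sq ?_ (mul_nonneg y.pos.le (Real.sinh_nonneg_iff.2 dist_nonneg))
      refine (norm_sq_le_of_orthogonal y _ (mink_proj x y)).trans (le_of_eq ?_)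
      rw [mul_pow, Real.sinh_sq, cosh_dist]
      simp only [mink_add_left, mink_add_right, mink_smul_left, mink_smul_right, x.eq_neg_one,
        y.eq_neg_one, mink_comm y.vec x.vec]
      ring
    · simpa using ((Real.continuous_sinh.tendsto 0).comp hd).const_mul y.vec.1
  have h1 : Tendsto (fun x => (w x).1) (𝓝 y) (𝓝 0) := by
    have : ∀ x, (w x).1 = inner ℝ (w x).2 y.vec.2 / y.vec.1 := fun x => by
      have := mink_proj x y
      rw [eq_div_iff y.pos.ne']
      exact (sub_eq_zero.1 this).symm
    simp only [this]
    simpa using (h2.inner (tendsto_const_nhds (x := y.vec.2))).div_const y.vec.1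
  have h3 : Tendsto w (𝓝 y) (𝓝 0) :=
    h1.prodMk_nhds h2
  have h4 : ∀ x : HypSpace n, x.vec = w x + Real.cosh (dist x y) • y.vec := fun x => by
    rw [hw, cosh_dist]; simp
  have h5 := h3.add ((((Real.continuous_cosh.tendsto 0).comp hd)).smul_const y.vec)
  rw [ContinuousAt, funext h4]
  simpa [hw, y.eq_neg_one] using h5

/-- Vertical projection of the hyperboloid onto Euclidean space. -/
noncomputable def homeomorphEuclidean : HypSpace n ≃ₜ EuclideanSpace ℝ (Fin n) where
  toFun x := x.vec.2
  invFun v := ⟨(√(1 + ‖v‖ ^ 2), v), Real.sqrt_pos.2 (by positivity), by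
    simp only [mink, real_inner_self_eq_norm_sq]
    rw [Real.mul_self_sqrt (by positivity)]; ring⟩
  left_inv x := by
    have h := x.eq_neg_one
    simp only [mink, real_inner_self_eq_norm_sq] at h
    refine HypSpace.ext (Prod.ext ?_ rfl)
    show √(1 + ‖x.vec.2‖ ^ 2) = x.vec.1
    rw [show 1 + ‖x.vec.2‖ ^ 2 = x.vec.1 ^ 2 by linarith, Real.sqrt_sq x.pos.le]
  right_inv v := rfl
  continuous_toFun := continuous_snd.comp continuous_vec
  continuous_invFun := continuous_of_continuous_vec (by
    show Continuous fun v : EuclideanSpace ℝ (Fin n) => (√(1 + ‖v‖ ^ 2), v)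
    fun_prop)

/-- Local compactness is used to pass from a free, properly discontinuous action to a covering map.
-/
instance : LocallyCompactSpace (HypSpace n) :=
  homeomorphEuclidean.isClosedEmbedding.locallyCompactSpace

/-! ### Geodesic segments -/

theorem mink_eq_neg_cosh (x y : HypSpace n) : mink x.vec y.vec = -Real.cosh (dist x y) := by
  rw [cosh_dist, neg_neg]

theorem dist_eq_of_cosh_eq {x y : HypSpace n} {r : ℝ} (hr : 0 ≤ r)
    (h : -mink x.vec y.vec = Real.cosh r) : dist x y = r := by
  rw [dist_def, h, Real.arcosh_cosh hr]

/-- The right side is minus the Lorentz square of `(1 - s) x + s y`; as `-⟨x, y⟩ ≥ 1`, it is at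
least `((1 - s) + s)² = 1`. Its root is the normalizing factor of `seg`. -/
theorem one_le_comb (x y : HypSpace n) (s : I) :
    1 ≤ (1 - (s : ℝ)) ^ 2 + (s : ℝ) ^ 2 - 2 * s * (1 - s) * mink x.vec y.vec := by
  have h := one_le_neg_mink x y
  have h1 : 0 ≤ (s : ℝ) * (1 - s) := mul_nonneg s.2.1 (sub_nonneg.2 s.2.2)
  nlinarith

/-- The point at parameter `s` of the geodesic segment from `x` to `y`: the radial projection of
the corresponding point of the affine segment. -/
noncomputable def seg (x y : HypSpace n) (s : I) : HypSpace n where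
  vec := (√((1 - (s : ℝ)) ^ 2 + (s : ℝ) ^ 2 - 2 * s * (1 - s) * mink x.vec y.vec))⁻¹ •
    ((1 - (s : ℝ)) • x.vec + (s : ℝ) • y.vec)
  pos := by
    have h := one_le_comb x y s
    have hx := x.pos
    have hy := y.pos
    have h1 := s.2.1
    have h2 := s.2.2
    simp only [Prod.smul_fst, Prod.fst_add, smul_eq_mul]
    refine mul_pos (inv_pos.2 (Real.sqrt_pos.2 (by linarith))) ?_
    rcases h1.eq_or_lt with h0 | h0
    · rw [← h0]; simpa using hx
    · have := mul_pos h0 hy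
      have := mul_nonneg (sub_nonneg.2 h2) hx.le
      linarith
  eq_neg_one := by
    have h := one_le_comb x y s
    have h0 : 0 < (1 - (s : ℝ)) ^ 2 + (s : ℝ) ^ 2 - 2 * s * (1 - s) * mink x.vec y.vec := by
      linarith
    set N := (1 - (s : ℝ)) ^ 2 + (s : ℝ) ^ 2 - 2 * s * (1 - s) * mink x.vec y.vec with hN
    simp only [mink_add_left, mink_add_right, mink_smul_left, mink_smul_right, x.eq_neg_one,
      y.eq_neg_one, mink_comm y.vec x.vec]
    trans (√N * √N)⁻¹ * -N
    · rw [mul_inv, hN]; ring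
    · rw [Real.mul_self_sqrt h0.le, mul_neg, inv_mul_cancel₀ h0.ne']

theorem seg_vec (x y : HypSpace n) (s : I) : (seg x y s).vec =
    (√((1 - (s : ℝ)) ^ 2 + (s : ℝ) ^ 2 - 2 * s * (1 - s) * mink x.vec y.vec))⁻¹ •
      ((1 - (s : ℝ)) • x.vec + (s : ℝ) • y.vec) := rfl

@[simp] theorem seg_zero (x y : HypSpace n) : seg x y 0 = x := by
  ext1; simp [seg]

@[simp] theorem seg_one (x y : HypSpace n) : seg x y 1 = y := by
  ext1; simp [seg]

@[simp] theorem seg_self (x : HypSpace n) (s : I) : seg x x s = x := by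
  ext1
  rw [seg_vec, x.eq_neg_one, ← add_smul,
    show (1 - (s : ℝ)) ^ 2 + (s : ℝ) ^ 2 - 2 * s * (1 - s) * -1 = 1 by ring]
  simp

theorem continuous_seg :
    Continuous fun p : HypSpace n × HypSpace n × I => seg p.1 p.2.1 p.2.2 := by
  apply continuous_of_continuous_vec
  have h1 : Continuous fun p : HypSpace n × HypSpace n × I => p.1.vec :=
    continuous_vec.comp continuous_fst
  have h2 : Continuous fun p : HypSpace n × HypSpace n × I => p.2.1.vec :=
    continuous_vec.comp (continuous_fst.comp continuous_snd)
  have h3 : Continuous fun p : HypSpace n × HypSpace n × I => (p.2.2 : ℝ) :=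
    continuous_subtype_val.comp (continuous_snd.comp continuous_snd)
  have h4 := continuous_mink.comp (h1.prodMk h2)
  refine Continuous.smul (Continuous.inv₀ (Real.continuous_sqrt.comp ?_) fun p => ?_) ?_
  · exact (((continuous_const.sub h3).pow 2).add (h3.pow 2)).sub
      (((continuous_const.mul h3).mul (continuous_const.sub h3)).mul h4)
  · exact (Real.sqrt_pos.2 (by linarith [one_le_comb p.1 p.2.1 p.2.2])).ne'
  · exact ((continuous_const.sub h3).smul h1).add (h3.smul h2)

/-- A point of the span of `x` and `y` is determined by its distances to `x` and `y`. -/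
theorem eq_of_mink_eq_of_span {x y z z' : HypSpace n} {a b : ℝ}
    (hz : z.vec = a • x.vec + b • y.vec) (hx : mink x.vec z.vec = mink x.vec z'.vec)
    (hy : mink y.vec z.vec = mink y.vec z'.vec) : z = z' := by
  refine dist_eq_zero.1 (dist_eq_of_cosh_eq le_rfl ?_)
  have h1 := z.eq_neg_one
  have : mink z.vec z.vec = mink z.vec z'.vec := by
    nth_rw 1 [hz]
    rw [mink_add_left, mink_smul_left, mink_smul_left, hx, hy, hz, mink_add_left, mink_smul_left,
      mink_smul_left]
  rw [← this, h1]; simp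

/-- The normalization of `z` reads `a² + b² + 2ab cosh L = 1`. It gives `sinh (dist x z) = b sinh L`
and `sinh (dist z y) = a sinh L`, and the addition formula for `cosh` returns `cosh L`. -/
theorem dist_add_dist_of_comb {x y z : HypSpace n} {a b : ℝ} (ha : 0 ≤ a) (hb : 0 ≤ b)
    (hz : z.vec = a • x.vec + b • y.vec) : dist x z + dist z y = dist x y := by
  set L := dist x y with hL
  have hL0 : 0 ≤ L := dist_nonneg
  have hxy := mink_eq_neg_cosh x y
  rw [← hL] at hxy
  have hS : Real.sinh L ^ 2 = Real.cosh L ^ 2 - 1 := Real.sinh_sq L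
  have hS0 : 0 ≤ Real.sinh L := Real.sinh_nonneg_iff.2 hL0
  have h1 : a ^ 2 + b ^ 2 + 2 * a * b * Real.cosh L = 1 := by
    have := z.eq_neg_one
    rw [hz] at this
    simp only [mink_add_left, mink_add_right, mink_smul_left, mink_smul_right, x.eq_neg_one,
      y.eq_neg_one, mink_comm y.vec x.vec, hxy] at this
    linarith
  have c1 : Real.cosh (dist x z) = a + b * Real.cosh L := by
    rw [cosh_dist, hz, mink_add_right, mink_smul_right, mink_smul_right, x.eq_neg_one, hxy]; ring
  have c2 : Real.cosh (dist z y) = a * Real.cosh L + b := by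
    rw [cosh_dist, hz, mink_add_left, mink_smul_left, mink_smul_left, y.eq_neg_one, hxy]; ring
  have s1 : Real.sinh (dist x z) = b * Real.sinh L := by
    refine (pow_left_inj₀ (Real.sinh_nonneg_iff.2 dist_nonneg) (mul_nonneg hb hS0)
      two_ne_zero).1 ?_
    rw [Real.sinh_sq, c1, mul_pow, hS]; linear_combination (1 : ℝ) * h1
  have s2 : Real.sinh (dist z y) = a * Real.sinh L := by
    refine (pow_left_inj₀ (Real.sinh_nonneg_iff.2 dist_nonneg) (mul_nonneg ha hS0)
      two_ne_zero).1 ?_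
    rw [Real.sinh_sq, c2, mul_pow, hS]; linear_combination (1 : ℝ) * h1
  have hc : Real.cosh (dist x z + dist z y) = Real.cosh L := by
    rw [Real.cosh_add, c1, c2, s1, s2]
    linear_combination a * b * hS + Real.cosh L * h1
  have := Real.cosh_le_cosh.1 hc.le
  have h' := Real.cosh_le_cosh.1 hc.ge
  rw [abs_of_nonneg hL0, abs_of_nonneg (add_nonneg dist_nonneg dist_nonneg)] at this h'
  exact le_antisymm this h'

theorem seg_dist_add_of_le (x y : HypSpace n) {s t : I} (h : s ≤ t) :
    dist x (seg x y s) + dist (seg x y s) (seg x y t) = dist x (seg x y t) := by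
  have hst : (s : ℝ) ≤ t := h
  rcases (show (0 : ℝ) ≤ t from t.2.1).eq_or_lt with h0 | h0
  · have : s = t := le_antisymm h (Subtype.coe_le_coe.1 (by rw [← h0]; exact s.2.1))
    subst this; simp
  -- Before normalization, the point at `s` is `(1 - s/t) x + (s/t) ·` the point at `t`. Here `N`
  -- and `M` stand for the two normalizing roots.
  have key : ∀ {N M : ℝ}, 0 < N → 0 < M → ∃ a b : ℝ, 0 ≤ a ∧ 0 ≤ b ∧
      N⁻¹ • ((1 - (s : ℝ)) • x.vec + (s : ℝ) • y.vec) =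
        a • x.vec + b • (M⁻¹ • ((1 - (t : ℝ)) • x.vec + (t : ℝ) • y.vec)) := by
    intro N M hN hM
    refine ⟨N⁻¹ * (1 - s / t), N⁻¹ * (s / t) * M, ?_, ?_, ?_⟩
    · exact mul_nonneg (inv_nonneg.2 hN.le) (sub_nonneg.2 ((div_le_one h0).2 hst))
    · exact mul_nonneg (mul_nonneg (inv_nonneg.2 hN.le) (div_nonneg s.2.1 h0.le)) hM.le
    · rw [smul_smul, mul_assoc _ M, mul_inv_cancel₀ hM.ne', mul_one]
      match_scalars
      · field_simp; ring
      · field_simp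
  obtain ⟨a, b, ha, hb, e⟩ := key
    (Real.sqrt_pos.2 (zero_lt_one.trans_le (one_le_comb x y s)))
    (Real.sqrt_pos.2 (zero_lt_one.trans_le (one_le_comb x y t)))
  exact dist_add_dist_of_comb (z := seg x y s) (y := seg x y t) ha hb e

/-- The parametrization does not have constant speed, but the distance from `x` is monotone along
the segment and its increments are the distances between successive points. The variation of a
monotone real function is the difference of its end values. -/
theorem eVariationOn_seg_le (x y : HypSpace n) :
    eVariationOn (seg x y) Set.univ ≤ edist x y := by
  set D : I → ℝ := fun s => dist x (seg x y s) with hD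
  have hmono : Monotone D := fun s t h => by
    have := seg_dist_add_of_le x y h
    have h2 : 0 ≤ dist (seg x y s) (seg x y t) := dist_nonneg
    simp only [hD]; linarith
  have h1 : eVariationOn (seg x y) Set.univ ≤ eVariationOn D Set.univ := by
    refine iSup_le fun ⟨k, u, hu, us⟩ => ?_
    refine le_trans (Finset.sum_le_sum fun i _ => ?_) (eVariationOn.sum_le (n := k) hu us)
    have := seg_dist_add_of_le x y (hu (Nat.le_succ i))
    rw [edist_dist, edist_dist]
    refine ENNReal.ofReal_le_ofReal ?_
    rw [Real.dist_eq, dist_comm]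
    refine le_trans (le_of_eq ?_) (le_abs_self _)
    simp only [hD]; linarith
  refine h1.trans ?_
  have := (hmono.monotoneOn Set.univ).eVariationOn_eq (Set.mem_univ (0 : I)) (Set.mem_univ 1)
  have hI : (Set.univ ∩ Set.Icc (0 : I) 1) = Set.univ := by
    ext t; simp [unitInterval.le_one']
  rw [hI] at this
  rw [this, edist_dist]
  simp [hD]

/-- A path that is no longer than the distance of its endpoints is monotone. -/
theorem dist_eq_sub_of_eVariationOn_le {p : I → HypSpace n}
    (h : eVariationOn p Set.univ ≤ edist (p 0) (p 1)) {s t : I} (hst : s ≤ t) :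
    dist (p s) (p t) = dist (p 0) (p t) - dist (p 0) (p s) ∧
      dist (p 0) (p s) + dist (p s) (p 1) = dist (p 0) (p 1) := by
  -- The three chords cut off at `s` and `t` are together no longer than the path, so the triangle
  -- inequalities become equalities.
  have key : ∀ {s t : I}, s ≤ t →
      dist (p 0) (p s) + dist (p s) (p t) + dist (p t) (p 1) ≤ dist (p 0) (p 1) := by
    intro s t hst
    have h0 : eVariationOn p (Set.univ ∩ Set.Icc 0 s) + eVariationOn p (Set.univ ∩ Set.Icc s t) +
        eVariationOn p (Set.univ ∩ Set.Icc t 1) ≤ eVariationOn p Set.univ := by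
      rw [eVariationOn.Icc_add_Icc p (unitInterval.nonneg' ) hst (Set.mem_univ _),
        eVariationOn.Icc_add_Icc p (unitInterval.nonneg') unitInterval.le_one' (Set.mem_univ _)]
      exact eVariationOn.mono p Set.inter_subset_left
    have h1 := eVariationOn.edist_le p (s := Set.univ ∩ Set.Icc 0 s) (x := 0) (y := s)
      ⟨trivial, le_rfl, unitInterval.nonneg'⟩ ⟨trivial, unitInterval.nonneg', le_rfl⟩
    have h2 := eVariationOn.edist_le p (s := Set.univ ∩ Set.Icc s t) (x := s) (y := t)
      ⟨trivial, le_rfl, hst⟩ ⟨trivial, hst, le_rfl⟩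
    have h3 := eVariationOn.edist_le p (s := Set.univ ∩ Set.Icc t 1) (x := t) (y := 1)
      ⟨trivial, le_rfl, unitInterval.le_one'⟩ ⟨trivial, unitInterval.le_one', le_rfl⟩
    have h4 := ((add_le_add (add_le_add h1 h2) h3).trans h0).trans h
    rw [edist_dist, edist_dist, edist_dist, edist_dist, ← ENNReal.ofReal_add dist_nonneg dist_nonneg,
      ← ENNReal.ofReal_add (by positivity) dist_nonneg,
      ENNReal.ofReal_le_ofReal_iff dist_nonneg] at h4
    exact h4
  have h1 := key hst
  have h2 := dist_triangle (p 0) (p t) (p 1)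
  have h3 := dist_triangle (p 0) (p s) (p t)
  have h4 := key (le_refl s)
  have h5 := dist_triangle (p 0) (p s) (p 1)
  rw [dist_self] at h4
  constructor <;> linarith

section Isometry

variable {Γ : Type*} [Group Γ] [MulAction Γ (HypSpace n)] [IsIsometricSMul Γ (HypSpace n)]

theorem mink_smul_smul (g : Γ) (x y : HypSpace n) :
    mink (g • x).vec (g • y).vec = mink x.vec y.vec := by
  rw [mink_eq_neg_cosh, dist_smul, ← mink_eq_neg_cosh]

/-- The action is only known to preserve distances, not to be linear, so the image point is
recognized by its distances to the new endpoints. -/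
theorem smul_seg (g : Γ) (x y : HypSpace n) (s : I) :
    g • seg x y s = seg (g • x) (g • y) s := by
  refine (eq_of_mink_eq_of_span (x := g • x) (y := g • y)
    ((smul_add _ _ _).trans (by rw [smul_smul, smul_smul])) ?_ ?_).symm
  all_goals
    rw [mink_smul_smul]
    simp only [seg, mink_smul_right, mink_add_right, mink_smul_smul, eq_neg_one]

end Isometry

end HypSpace

namespace HypSpace

open Filter Topology

variable {n : ℕ}

/-! ### Directions, angles and the first variation of length -/

theorem mink_direction_left (x p : HypSpace n) : mink (direction x p) x.vec = 0 := by
  rw [direction, mink_comm x.vec]; exact mink_proj p x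

theorem mink_direction_right {u : ℝ × EuclideanSpace ℝ (Fin n)} {x : HypSpace n}
    (hu : mink u x.vec = 0) (p : HypSpace n) : mink u (direction x p) = mink u p.vec := by
  rw [direction, mink_add_right, mink_smul_right, hu, mul_zero, add_zero]

theorem mink_direction_self (x p : HypSpace n) :
    mink (direction x p) (direction x p) = Real.sinh (dist x p) ^ 2 := by
  rw [mink_direction_right (mink_direction_left x p), direction, mink_add_left, mink_smul_left,
    p.eq_neg_one, Real.sinh_sq, cosh_dist]
  ring

/-- The unit tangent vector at `x` pointing to `p`. -/
noncomputable def unitDirection (x p : HypSpace n) : ℝ × EuclideanSpace ℝ (Fin n) :=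
  (Real.sinh (dist x p))⁻¹ • direction x p

theorem mink_unitDirection_left (x p : HypSpace n) : mink (unitDirection x p) x.vec = 0 := by
  rw [unitDirection, mink_smul_left, mink_direction_left, mul_zero]

theorem sinh_dist_pos {x p : HypSpace n} (h : p ≠ x) : 0 < Real.sinh (dist x p) :=
  Real.sinh_pos_iff.2 (dist_pos.2 h.symm)

theorem mink_unitDirection_self {x p : HypSpace n} (h : p ≠ x) :
    mink (unitDirection x p) (unitDirection x p) = 1 := by
  have := (sinh_dist_pos h).ne'
  rw [unitDirection, mink_smul_left, mink_smul_right, mink_direction_self]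
  field_simp

theorem mink_vec_of_orthogonal {u : ℝ × EuclideanSpace ℝ (Fin n)} {x p : HypSpace n}
    (hu : mink u x.vec = 0) (h : p ≠ x) :
    mink u p.vec = Real.sinh (dist x p) * mink u (unitDirection x p) := by
  have := (sinh_dist_pos h).ne'
  rw [unitDirection, mink_smul_right, mink_direction_right hu, mul_inv_cancel_left₀ this]

theorem angle_eq_arccos (x p q : HypSpace n) :
    angle x p q = Real.arccos (mink (unitDirection x p) (unitDirection x q)) := by
  have hp : 0 ≤ Real.sinh (dist x p) := Real.sinh_nonneg_iff.2 dist_nonneg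
  have hq : 0 ≤ Real.sinh (dist x q) := Real.sinh_nonneg_iff.2 dist_nonneg
  rw [angle, mink_direction_self, mink_direction_self, Real.sqrt_sq hp, Real.sqrt_sq hq,
    unitDirection, unitDirection, mink_smul_left, mink_smul_right, div_eq_inv_mul, mul_inv]
  ring_nf

theorem angle_comm (x p q : HypSpace n) : angle x p q = angle x q p := by
  rw [angle_eq_arccos, angle_eq_arccos, mink_comm]

theorem arccos_neg_half : Real.arccos (-(1 / 2)) = 2 * Real.pi / 3 := by
  rw [Real.arccos_neg, ← Real.cos_pi_div_three, Real.arccos_cos (by positivity)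
    (by linarith [Real.pi_pos])]
  ring

/-- `Real.arccos` is strictly decreasing only on `[-1, 1]`; Cauchy–Schwarz places the product there.
-/
theorem mink_unitDirection_le_iff {x p q : HypSpace n} (hp : p ≠ x) (hq : q ≠ x) :
    mink (unitDirection x p) (unitDirection x q) ≤ -(1 / 2) ↔
      2 * Real.pi / 3 ≤ angle x p q := by
  have h := mink_cauchy_schwarz x _ _ (mink_unitDirection_left x p) (mink_unitDirection_left x q)
  rw [mink_unitDirection_self hp, mink_unitDirection_self hq, mul_one] at h
  have h' := abs_le.1 ((sq_le_one_iff_abs_le_one _).1 h)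
  rw [angle_eq_arccos, ← arccos_neg_half]
  refine ⟨fun h => Real.antitone_arccos h, fun h => ?_⟩
  exact (Real.strictAntiOn_arccos.le_iff_ge (by constructor <;> norm_num) h').1 h

theorem mink_sum_left {ι : Type*} (s : Finset ι) (u : ι → ℝ × EuclideanSpace ℝ (Fin n))
    (w : ℝ × EuclideanSpace ℝ (Fin n)) : mink (∑ i ∈ s, u i) w = ∑ i ∈ s, mink (u i) w := by
  classical
  induction s using Finset.induction_on with
  | empty => simp [mink]
  | insert a s ha ih => rw [Finset.sum_insert ha, Finset.sum_insert ha, mink_add_left, ih]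

/-- There are at most three tangent directions that pairwise make an angle of at least `2π/3`. -/
theorem card_le_three_of_angle {ι : Type*} (x : HypSpace n) (s : Finset ι) (p : ι → HypSpace n)
    (hp : ∀ i ∈ s, p i ≠ x)
    (h : ∀ i ∈ s, ∀ j ∈ s, i ≠ j → 2 * Real.pi / 3 ≤ angle x (p i) (p j)) : s.card ≤ 3 := by
  classical
  set u : ι → ℝ × EuclideanSpace ℝ (Fin n) := fun i => unitDirection x (p i) with hu
  have h0 : 0 ≤ mink (∑ i ∈ s, u i) (∑ i ∈ s, u i) := by
    refine mink_self_nonneg x _ ?_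
    rw [mink_sum_left]
    exact Finset.sum_eq_zero fun i _ => mink_unitDirection_left x (p i)
  -- One term equals `1` and the other `card - 1` terms are at most `-1/2`.
  have h1 : ∀ i ∈ s, mink (u i) (∑ j ∈ s, u j) ≤ (3 - s.card) / 2 := by
    intro i hi
    rw [mink_comm, mink_sum_left, ← Finset.add_sum_erase s _ hi]
    have h2 : ∑ j ∈ s.erase i, mink (u j) (u i) ≤ (s.erase i).card • (-(1 / 2) : ℝ) := by
      refine Finset.sum_le_card_nsmul _ _ _ fun j hj => ?_
      obtain ⟨hji, hj⟩ := Finset.mem_erase.1 hj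
      exact (mink_unitDirection_le_iff (hp j hj) (hp i hi)).2 (h j hj i hi hji)
    have h3 : ((s.erase i).card : ℝ) = s.card - 1 := by
      rw [Finset.card_erase_of_mem hi, Nat.cast_sub (Finset.card_pos.2 ⟨i, hi⟩)]; simp
    rw [nsmul_eq_mul, h3] at h2
    have h4 : mink (u i) (u i) = 1 := mink_unitDirection_self (hp i hi)
    linarith
  rw [mink_sum_left] at h0
  have h2 := h0.trans (Finset.sum_le_card_nsmul s _ _ h1)
  rw [nsmul_eq_mul] at h2
  by_contra hc
  have h3 : (4 : ℝ) ≤ s.card := by exact_mod_cast not_le.1 hc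
  nlinarith

/-- The point at distance `|r|` from `x` on the geodesic with initial velocity `u`. -/
noncomputable def geodesic (x : HypSpace n) (u : ℝ × EuclideanSpace ℝ (Fin n))
    (hu : mink u x.vec = 0) (h1 : mink u u = 1) (r : ℝ) : HypSpace n where
  vec := Real.cosh r • x.vec + Real.sinh r • u
  pos := by
    have h := norm_sq_le_of_orthogonal x u hu
    rw [h1] at h
    -- Since `⟨u, u⟩ = 1`, the square of `u.1` is `‖u.2‖² - 1`, and `‖u.2‖² ≤ x.vec.1²`.
    have h2 : u.1 ^ 2 < x.vec.1 ^ 2 := by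
      simp only [mink, real_inner_self_eq_norm_sq] at h1
      nlinarith
    have h3 : Real.sinh r ^ 2 < Real.cosh r ^ 2 := by rw [Real.sinh_sq]; linarith
    have h4 := mul_lt_mul'' (sq_lt_sq.1 h2) (sq_lt_sq.1 h3) (abs_nonneg _) (abs_nonneg _)
    rw [← abs_mul, ← abs_mul, abs_of_pos (mul_pos x.pos (Real.cosh_pos r))] at h4
    have := neg_abs_le (u.1 * Real.sinh r)
    simp only [Prod.fst_add, Prod.smul_fst, smul_eq_mul]
    linarith
  eq_neg_one := by
    simp only [mink_add_left, mink_add_right, mink_smul_left, mink_smul_right, x.eq_neg_one, h1,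
      hu, mink_comm x.vec u]
    linear_combination -Real.cosh_sq_sub_sinh_sq r

theorem dist_geodesic_self (x : HypSpace n) {u : ℝ × EuclideanSpace ℝ (Fin n)}
    (hu : mink u x.vec = 0) (h1 : mink u u = 1) {r : ℝ} (hr : 0 ≤ r) :
    dist x (geodesic x u hu h1 r) = r := by
  refine dist_eq_of_cosh_eq hr ?_
  simp only [geodesic, mink_add_right, mink_smul_right, x.eq_neg_one, mink_comm x.vec u, hu]
  ring

/-- First variation of the distance along a geodesic. -/
theorem hasDerivAt_dist_geodesic (x : HypSpace n) {u : ℝ × EuclideanSpace ℝ (Fin n)}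
    (hu : mink u x.vec = 0) (h1 : mink u u = 1) {a : HypSpace n} (ha : a ≠ x) :
    HasDerivAt (fun r => dist (geodesic x u hu h1 r) a) (-mink u (unitDirection x a)) 0 := by
  set A := dist x a with hA
  set m := mink u (unitDirection x a) with hm
  have hA0 : 0 < A := dist_pos.2 ha.symm
  have hS : 0 < Real.sinh A := Real.sinh_pos_iff.2 hA0
  -- The hyperbolic law of cosines. As `a ≠ x`, its value at `r = 0` exceeds `1`, where `arcosh` is
  -- differentiable.
  have hfun : (fun r => dist (geodesic x u hu h1 r) a) =
      fun r => Real.arcosh (Real.cosh r * Real.cosh A - Real.sinh r * (Real.sinh A * m)) := by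
    funext r
    rw [dist_def]
    simp only [geodesic, mink_add_left, mink_smul_left]
    rw [mink_vec_of_orthogonal hu ha, mink_eq_neg_cosh x a]
    congr 1; ring
  rw [hfun]
  have hin : HasDerivAt
      (fun r => Real.cosh r * Real.cosh A - Real.sinh r * (Real.sinh A * m))
      (Real.sinh 0 * Real.cosh A - Real.cosh 0 * (Real.sinh A * m)) 0 :=
    ((Real.hasDerivAt_cosh 0).mul_const _).sub ((Real.hasDerivAt_sinh 0).mul_const _)
  have hval : Real.cosh 0 * Real.cosh A - Real.sinh 0 * (Real.sinh A * m) = Real.cosh A := by simp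
  have hout := Real.hasDerivAt_arcosh (x := Real.cosh A) (Real.one_lt_cosh.2 hA0.ne')
  rw [← hval] at hout
  refine (hout.comp 0 hin).congr_deriv ?_
  rw [hval, ← Real.sinh_sq, Real.sqrt_sq hS.le]
  simp
  field_simp

/-- If two segments make an angle less than `2π/3`, they can be replaced by a shorter tripod. -/
theorem exists_shorter_tripod {v a b : HypSpace n} (ha : a ≠ v) (hb : b ≠ v)
    (h : angle v a b < 2 * Real.pi / 3) :
    ∃ w, dist a w + dist v w + dist w b < dist a v + dist v b := by
  set c := mink (unitDirection v a) (unitDirection v b) with hc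
  have hc2 : -(1 / 2) < c := by
    by_contra hcon
    exact absurd ((mink_unitDirection_le_iff ha hb).1 (not_lt.1 hcon)) (not_le.2 h)
  -- `N` is the norm of the sum of the two unit vectors, and `u` below is the unit bisector. The
  -- angle hypothesis amounts to `N > 1`, and each leg shortens at the rate `N / 2`.
  set N := √(2 + 2 * c) with hN
  have hNsq : N * N = 2 + 2 * c := Real.mul_self_sqrt (by linarith)
  have hN1 : 1 < N := by
    rw [hN, Real.lt_sqrt zero_le_one]; linarith
  have hN0 : N ≠ 0 := by positivity
  set u := N⁻¹ • (unitDirection v a + unitDirection v b) with hu'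
  have hu : mink u v.vec = 0 := by
    rw [hu', mink_smul_left, mink_add_left, mink_unitDirection_left, mink_unitDirection_left]; simp
  have hua : mink u (unitDirection v a) = N / 2 := by
    rw [hu', mink_smul_left, mink_add_left, mink_unitDirection_self ha,
      mink_comm (unitDirection v b), ← hc]
    field_simp; linarith
  have hub : mink u (unitDirection v b) = N / 2 := by
    rw [hu', mink_smul_left, mink_add_left, mink_unitDirection_self hb, ← hc]
    field_simp; linarith
  have h1 : mink u u = 1 := by
    nth_rw 2 [hu']
    rw [mink_smul_right, mink_add_right, hua, hub]
    field_simp; ring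
  have hG := ((hasDerivAt_dist_geodesic v hu h1 ha).add (hasDerivAt_id (0 : ℝ))).add
    (hasDerivAt_dist_geodesic v hu h1 hb)
  have hneg : -mink u (unitDirection v a) + 1 + -mink u (unitDirection v b) < 0 := by
    rw [hua, hub]; linarith
  have hev := hG.tendsto_slope_zero_right.eventually_lt_const hneg
  obtain ⟨r, hr, hr0⟩ := (hev.and self_mem_nhdsWithin).exists
  have hr0 : 0 < r := hr0
  refine ⟨geodesic v u hu h1 r, ?_⟩
  have hz : geodesic v u hu h1 0 = v := by ext1; simp [geodesic]
  simp only [zero_add, Pi.add_apply, id, hz, add_zero, smul_eq_mul] at hr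
  rw [inv_mul_lt_iff₀ hr0, mul_zero] at hr
  rw [dist_comm a, dist_geodesic_self v hu h1 hr0.le, dist_comm a]
  linarith

/-- The tripod inequality in terms of extended distances. -/
theorem exists_edist_tripod_lt {v a b : HypSpace n} (ha : a ≠ v) (hb : b ≠ v)
    (h : angle v a b < 2 * Real.pi / 3) :
    ∃ w, edist a w + edist v w + edist w b < edist a v + edist v b := by
  obtain ⟨w, hw⟩ := exists_shorter_tripod ha hb h
  refine ⟨w, ?_⟩
  simp only [edist_dist]
  rw [← ENNReal.ofReal_add dist_nonneg dist_nonneg, ← ENNReal.ofReal_add (by positivity) dist_nonneg,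
    ← ENNReal.ofReal_add dist_nonneg dist_nonneg, ENNReal.ofReal_lt_ofReal_iff_of_nonneg
      (by positivity)]
  exact hw

/-- An interior point of a geodesic segment lies in the direction of its endpoint. -/
theorem unitDirection_eq_of_dist_add {x m q : HypSpace n} (hm : m ≠ x)
    (h : dist x m + dist m q = dist x q) : unitDirection x m = unitDirection x q := by
  set L := dist x q with hL
  set s := dist x m with hs
  have hs0 : 0 < s := dist_pos.2 hm.symm
  have hmq : dist m q = L - s := by linarith
  have hLs : 0 ≤ L - s := by rw [← hmq]; exact dist_nonneg
  have hSL : 0 < Real.sinh L := Real.sinh_pos_iff.2 (by linarith)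
  have hSs : 0 < Real.sinh s := Real.sinh_pos_iff.2 hs0
  have hSd : 0 ≤ Real.sinh (L - s) := Real.sinh_nonneg_iff.2 hLs
  have hxq := mink_eq_neg_cosh x q
  rw [← hL] at hxq
  have e1 := Real.sinh_sub L s
  have e2 := Real.cosh_sub L s
  have e3 := Real.cosh_sq_sub_sinh_sq L
  have e4 := Real.cosh_sq_sub_sinh_sq s
  -- The point at distance `s` from `x` on the segment to `q`, in explicit `sinh` weights. It has
  -- the same distances to `x` and `q` as `m`, hence equals `m`, and its direction is visibly a
  -- multiple of that of `q`.
  let z : HypSpace n :=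
    { vec := (Real.sinh (L - s) / Real.sinh L) • x.vec + (Real.sinh s / Real.sinh L) • q.vec
      pos := by
        have := mul_pos (div_pos hSs hSL) q.pos
        have := mul_nonneg (div_nonneg hSd hSL.le) x.pos.le
        simp only [Prod.fst_add, Prod.smul_fst, smul_eq_mul]
        linarith
      eq_neg_one := by
        simp only [mink_add_left, mink_add_right, mink_smul_left, mink_smul_right, x.eq_neg_one,
          q.eq_neg_one, mink_comm q.vec x.vec, hxq]
        field_simp
        rw [e1]
        linear_combination Real.sinh s ^ 2 * e3 - Real.sinh L ^ 2 * e4 }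
  have hz : z = m := by
    refine eq_of_mink_eq_of_span (x := x) (y := q) rfl ?_ ?_
    · rw [mink_eq_neg_cosh x m, ← hs]
      simp only [z, mink_add_right, mink_smul_right, x.eq_neg_one, hxq]
      field_simp
      rw [e1]; ring
    · rw [mink_eq_neg_cosh q m, dist_comm, hmq]
      simp only [z, mink_add_right, mink_smul_right, q.eq_neg_one, mink_comm q.vec x.vec, hxq]
      field_simp
      rw [e1, e2]
      linear_combination Real.sinh s * e3
  have hd : direction x m = (Real.sinh s / Real.sinh L) • direction x q := by
    rw [direction, direction, mink_eq_neg_cosh x m, ← hs, hxq, ← hz]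
    simp only [z]
    rw [e1]
    match_scalars
    · field_simp; ring
    · field_simp
  rw [unitDirection, unitDirection, hd, ← hs, ← hL, smul_smul]
  congr 1
  field_simp

end HypSpace

/-! ### Lifts of paths -/

section Lifts

variable {n : ℕ} {Γ : Type*} [Group Γ] [MulAction Γ (HypSpace n)]

/-- The covering projection `ℍⁿ → ℍⁿ / Γ`. -/
abbrev HypQuotient.proj (Γ : Type*) [Group Γ] [MulAction Γ (HypSpace n)] (x : HypSpace n) :
    HypQuotient n Γ :=
  Quotient.mk _ x

open HypQuotient

theorem HypQuotient.continuous_proj : Continuous (proj Γ : HypSpace n → HypQuotient n Γ) :=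
  continuous_quotient_mk'

theorem HypQuotient.proj_eq_iff {x y : HypSpace n} : proj Γ x = proj Γ y ↔ ∃ g : Γ, x = g • y := by
  rw [Quotient.eq, MulAction.orbitRel_apply, MulAction.mem_orbit_iff]
  simp only [eq_comm]

theorem HypQuotient.proj_smul (g : Γ) (x : HypSpace n) : proj Γ (g • x) = proj Γ x :=
  proj_eq_iff.2 ⟨g, rfl⟩

/-- Some lift of the path `γ` to `ℍⁿ` runs from `x` to `y`. -/
def LiftRel (γ : I → HypQuotient n Γ) (x y : HypSpace n) : Prop :=
  ∃ p : C(I, HypSpace n), IsLift p γ ∧ p 0 = x ∧ p 1 = y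

theorem LiftRel.source {γ : I → HypQuotient n Γ} {x y : HypSpace n} (h : LiftRel γ x y) :
    proj Γ x = γ 0 := by
  obtain ⟨p, hp, rfl, rfl⟩ := h; exact hp 0

theorem LiftRel.target {γ : I → HypQuotient n Γ} {x y : HypSpace n} (h : LiftRel γ x y) :
    proj Γ y = γ 1 := by
  obtain ⟨p, hp, rfl, rfl⟩ := h; exact hp 1

theorem IsLift.liftRel {γ : I → HypQuotient n Γ} {p : C(I, HypSpace n)} (h : IsLift p γ) :
    LiftRel γ (p 0) (p 1) := ⟨p, h, rfl, rfl⟩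

theorem LiftRel.refl (x : HypSpace n) {a : HypQuotient n Γ} (h : proj Γ x = a) :
    LiftRel (Path.refl a) x x :=
  ⟨.const I x, fun _ => h, rfl, rfl⟩

theorem LiftRel.trans {a b c : HypQuotient n Γ} {γ : Path a b} {δ : Path b c} {x y z : HypSpace n}
    (h₁ : LiftRel γ x y) (h₂ : LiftRel δ y z) : LiftRel (γ.trans δ) x z := by
  obtain ⟨p, hp, hp0, hp1⟩ := h₁
  obtain ⟨q, hq, hq0, hq1⟩ := h₂
  let P : Path x y := ⟨p, hp0, hp1⟩
  let Q : Path y z := ⟨q, hq0, hq1⟩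
  refine ⟨(P.trans Q).toContinuousMap, fun t => ?_, (P.trans Q).source, (P.trans Q).target⟩
  show proj Γ ((P.trans Q) t) = _
  rw [Path.trans_apply, Path.trans_apply]
  split_ifs
  · exact hp _
  · exact hq _

theorem IsLift.symm {a b : HypQuotient n Γ} {γ : Path a b} {p : C(I, HypSpace n)}
    (h : IsLift p γ) : IsLift (p.comp ⟨unitInterval.symm, unitInterval.continuous_symm⟩) γ.symm :=
  fun t => h (unitInterval.symm t)

theorem LiftRel.symm {a b : HypQuotient n Γ} {γ : Path a b} {x y : HypSpace n}
    (h : LiftRel γ x y) : LiftRel γ.symm y x := by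
  obtain ⟨p, hp, rfl, rfl⟩ := h
  simpa using hp.symm.liftRel

theorem LiftRel.subpath {a b : HypQuotient n Γ} {γ : Path a b} {p : C(I, HypSpace n)}
    (h : IsLift p γ) (s t : I) : LiftRel (γ.subpath s t) (p s) (p t) := by
  refine ⟨p.comp ⟨Set.Icc.convexComb s t, by fun_prop⟩, fun r => h _, ?_, ?_⟩ <;> simp

variable [IsIsometricSMul Γ (HypSpace n)] [ProperlyDiscontinuousSMul Γ (HypSpace n)]
  [IsCancelSMul Γ (HypSpace n)]

theorem HypQuotient.isCoveringMap_proj :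
    IsCoveringMap (proj Γ : HypSpace n → HypQuotient n Γ) :=
  isQuotientCoveringMap_quotientMk_of_properlyDiscontinuousSMul.isCoveringMap

theorem exists_isLift {a b : HypQuotient n Γ} (γ : Path a b) {x : HypSpace n} (h : proj Γ x = a) :
    ∃ p : C(I, HypSpace n), IsLift p γ ∧ p 0 = x := by
  obtain ⟨p, hp, h0⟩ := (isCoveringMap_proj (n := n) (Γ := Γ)).exists_path_lifts γ x
    (by rw [h]; exact γ.source)
  exact ⟨p, fun t => congrFun hp t, h0⟩

theorem IsLift.eq_of_zero {γ : I → HypQuotient n Γ} {p q : C(I, HypSpace n)} (hp : IsLift p γ)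
    (hq : IsLift q γ) (h : p 0 = q 0) : p = q :=
  DFunLike.coe_injective <| (isCoveringMap_proj (n := n) (Γ := Γ)).eq_of_comp_eq p.continuous
    q.continuous (funext fun t => (hp t).trans (hq t).symm) 0 h

/-- The starting points lie in one orbit; a translate of `q` is a lift starting where `p` does, and
lifts are unique. -/
theorem IsLift.exists_smul_eq {γ : I → HypQuotient n Γ} {p q : C(I, HypSpace n)} (hp : IsLift p γ)
    (hq : IsLift q γ) : ∃ g : Γ, ∀ t, p t = g • q t := by
  obtain ⟨g, hg⟩ := proj_eq_iff.1 ((hp 0).trans (hq 0).symm)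
  have hq' : IsLift ⟨fun t => g • q t, q.continuous.const_smul g⟩ γ :=
    fun t => (proj_smul g _).trans (hq t)
  have := hp.eq_of_zero hq' hg
  exact ⟨g, fun t => DFunLike.congr_fun this t⟩

theorem IsLift.pathLength_eq {γ : I → HypQuotient n Γ} {p : C(I, HypSpace n)} (hp : IsLift p γ) :
    pathLength γ = eVariationOn p Set.univ := by
  refine le_antisymm (iInf₂_le p hp) (le_iInf₂ fun q hq => ?_)
  obtain ⟨g, hg⟩ := hp.exists_smul_eq hq
  simp only [eVariationOn, hg, edist_smul_left, le_refl]

theorem LiftRel.edist_le {γ : I → HypQuotient n Γ} {x y : HypSpace n} (h : LiftRel γ x y) :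
    edist x y ≤ pathLength γ := by
  obtain ⟨p, hp, rfl, rfl⟩ := h
  rw [hp.pathLength_eq]
  exact eVariationOn.edist_le p (Set.mem_univ _) (Set.mem_univ _)

theorem LiftRel.exists_smul_eq {γ : I → HypQuotient n Γ} {x y x' y' : HypSpace n}
    (h : LiftRel γ x y) (h' : LiftRel γ x' y') : ∃ g : Γ, x = g • x' ∧ y = g • y' := by
  obtain ⟨p, hp, rfl, rfl⟩ := h
  obtain ⟨q, hq, rfl, rfl⟩ := h'
  obtain ⟨g, hg⟩ := hp.exists_smul_eq hq
  exact ⟨g, hg 0, hg 1⟩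

/-- Lifting the two pieces one after the other gives a lift of the concatenation with the same
start, hence the given one. -/
theorem LiftRel.trans_split {a b c : HypQuotient n Γ} {γ : Path a b} {δ : Path b c}
    {x z : HypSpace n} (h : LiftRel (γ.trans δ) x z) :
    ∃ y, LiftRel γ x y ∧ LiftRel δ y z := by
  obtain ⟨r, hr, rfl, rfl⟩ := h
  obtain ⟨p, hp, hp0⟩ := exists_isLift γ ((hr 0).trans (γ.trans δ).source)
  obtain ⟨q, hq, hq0⟩ := exists_isLift δ ((hp 1).trans γ.target)
  obtain ⟨s, hs, hs0, hs1⟩ := (hp0 ▸ hp.liftRel).trans (hq0 ▸ hq.liftRel)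
  have := hs.eq_of_zero hr hs0
  subst this
  exact ⟨p 1, hp0 ▸ hp.liftRel, hq0 ▸ hs1 ▸ hq.liftRel⟩

/-- Lifts of homotopic paths with a common start have a common end, and the constant path lifts to a
constant. -/
theorem LiftRel.eq_of_homotopic_refl {a : HypQuotient n Γ} {γ : Path a a} {x y : HypSpace n}
    (h : LiftRel γ x y) (hγ : γ.Homotopic (Path.refl a)) : x = y := by
  obtain ⟨p, hp, rfl, rfl⟩ := h
  have cov := isCoveringMap_proj (n := n) (Γ := Γ)
  have h0 : proj Γ (p 0) = a := (hp 0).trans γ.source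
  have key := cov.liftPath_apply_one_eq_of_homotopicRel hγ (p 0) (γ.source.trans h0.symm)
    ((Path.refl a).source.trans h0.symm)
  have e1 := (cov.eq_liftPath_iff' (γ := γ.toContinuousMap) (γ.source.trans h0.symm)).2
    ⟨funext fun t => hp t, rfl⟩
  have e2 := (cov.eq_liftPath_iff' (Γ := .const I (p 0)) (γ := (Path.refl a).toContinuousMap)
    ((Path.refl a).source.trans h0.symm)).2 ⟨funext fun t => h0, rfl⟩
  rw [← e1, ← e2] at key
  exact key.symm

/-- A path that is no longer than the distance of the endpoints of a lift is geodesic. -/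
theorem IsLift.isGeodesicSegment {γ : I → HypQuotient n Γ} {p : C(I, HypSpace n)}
    (hp : IsLift p γ) (h : pathLength γ ≤ edist (p 0) (p 1)) : IsGeodesicSegment γ := by
  rw [hp.pathLength_eq] at h
  let φ : C(I, ℝ) := ⟨fun t => dist (p 0) (p t), by fun_prop⟩
  have hdist : ∀ s t, dist (p s) (p t) = |φ s - φ t| := by
    intro s t
    rcases le_total s t with hst | hst
    · have := (HypSpace.dist_eq_sub_of_eVariationOn_le h hst).1
      rw [abs_sub_comm]
      exact this.trans (abs_of_nonneg (dist_nonneg.trans_eq this)).symm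
    · have := (HypSpace.dist_eq_sub_of_eVariationOn_le h hst).1
      rw [dist_comm]
      exact this.trans (abs_of_nonneg (dist_nonneg.trans_eq this)).symm
  have hmono : Monotone φ := fun s t hst => by
    have := (HypSpace.dist_eq_sub_of_eVariationOn_le h hst).1
    exact sub_nonneg.1 (dist_nonneg.trans_eq this)
  have h0 : φ 0 = 0 := dist_self (p 0)
  have hsurj : ∀ r ∈ Set.Icc 0 (φ 1), ∃ t, φ t = r := by
    intro r hr
    have := intermediate_value_Icc (zero_le_one' I) φ.continuous.continuousOn
    rw [h0] at this
    obtain ⟨t, -, ht⟩ := this hr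
    exact ⟨t, ht⟩
  classical
  -- The geodesic sends `r` to `p t` for any `t` with `φ t = r`; the choice is immaterial because
  -- `dist (p s) (p t) = |φ s - φ t|`. The default `p 0` is never taken on `[0, φ 1]`.
  refine ⟨φ 1, fun r => if h : ∃ t, φ t = r then p h.choose else p 0, φ,
    by rw [← h0]; exact hmono (zero_le_one' I), ?_, hmono, h0, rfl, fun t => ?_⟩
  · intro r hr s hs
    have hr' := hsurj r hr
    have hs' := hsurj s hs
    beta_reduce
    rw [dif_pos hr', dif_pos hs', hdist, hr'.choose_spec, hs'.choose_spec]
  · have ht : ∃ t', φ t' = φ t := ⟨t, rfl⟩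
    beta_reduce
    rw [← hp t, dif_pos ht]
    congr 1
    rw [← dist_eq_zero, hdist, ht.choose_spec, sub_self, abs_zero]

end Lifts

/-! ### Walks -/

namespace MGraph.Walk

variable {X : MGraph}

/-- Concatenation of edge paths. -/
def append {u v w : X.V} : X.Walk u v → X.Walk v w → X.Walk u w
  | .nil _, q => q
  | .cons d h p, q => .cons d h (p.append q)

theorem edges_append {u v w : X.V} (p : X.Walk u v) (q : X.Walk v w) :
    (p.append q).edges = p.edges ++ q.edges := by
  induction p with
  | nil => rfl
  | cons d h p ih => simp [append, edges, ih]

end MGraph.Walk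

/-! ### Lifts of edge paths: concatenation, reversal and cutting -/

namespace GraphMap

open HypQuotient

section Lifts

variable {n : ℕ} {Γ : Type*} [Group Γ] [MulAction Γ (HypSpace n)] {X : MGraph}
  (f : GraphMap X (HypQuotient n Γ))

theorem liftRel_walkPath_cons {u v : X.V} {d : X.Dart} {h : X.init d = u}
    {p : X.Walk (X.term d) v} {x y z : HypSpace n} (h₁ : LiftRel (f.dartPath d) x y)
    (h₂ : LiftRel (f.walkPath p) y z) : LiftRel (f.walkPath (.cons d h p)) x z := by
  subst h
  exact h₁.trans h₂

theorem liftRel_walkPath_append {u v w : X.V} (p : X.Walk u v) (q : X.Walk v w)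
    {x y z : HypSpace n} [IsIsometricSMul Γ (HypSpace n)]
    [ProperlyDiscontinuousSMul Γ (HypSpace n)] [IsCancelSMul Γ (HypSpace n)]
    (h₁ : LiftRel (f.walkPath p) x y) (h₂ : LiftRel (f.walkPath q) y z) :
    LiftRel (f.walkPath (p.append q)) x z := by
  induction p generalizing x with
  | nil v =>
    obtain ⟨r, hr, rfl, rfl⟩ := h₁
    have : r = .const I (r 0) :=
      hr.eq_of_zero (fun t => hr 0) rfl
    rw [this] at h₂
    exact h₂
  | cons d h p ih =>
    subst h
    obtain ⟨y', h3, h4⟩ := LiftRel.trans_split h₁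
    exact f.liftRel_walkPath_cons h3 (ih q h4 h₂)

theorem liftRel_dartPath_flip {e : X.E} {b : Bool} {x y : HypSpace n}
    (h : LiftRel (f.dartPath (e, b)) x y) : LiftRel (f.dartPath (e, !b)) y x := by
  cases b
  · obtain ⟨p, hp, rfl, rfl⟩ := h
    have : IsLift p (f.edge e).symm := hp
    have := this.symm
    rw [Path.symm_symm] at this
    have h2 : LiftRel (f.edge e) (p 1) (p 0) := by simpa using this.liftRel
    exact h2
  · exact LiftRel.symm h

variable [IsIsometricSMul Γ (HypSpace n)] [ProperlyDiscontinuousSMul Γ (HypSpace n)]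
  [IsCancelSMul Γ (HypSpace n)]

/-- The edge path `p`, run through backwards. -/
theorem exists_reverse_walk {u v : X.V} (p : X.Walk u v) : ∃ q : X.Walk v u,
    (∀ e ∈ q.edges, e ∈ p.edges) ∧ ∀ x y, LiftRel (f.walkPath p) x y → LiftRel (f.walkPath q) y x := by
  induction p with
  | nil v => exact ⟨.nil v, fun e he => he, fun x y h => by
    have := LiftRel.symm (γ := Path.refl (f.vert v)) h
    rwa [Path.refl_symm] at this⟩
  | cons d h p ih =>
    subst h
    obtain ⟨q, hq, hl⟩ := ih
    obtain ⟨e, b⟩ := d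
    have hi : X.init (e, !b) = X.term (e, b) := by cases b <;> rfl
    have ht : X.term (e, !b) = X.init (e, b) := by cases b <;> rfl
    obtain ⟨r, hr, hrl⟩ : ∃ r : X.Walk (X.term (e, b)) (X.init (e, b)), r.edges = [e] ∧
        ∀ x y, LiftRel (f.dartPath (e, !b)) x y → LiftRel (f.walkPath r) x y := by
      rw [← hi, ← ht]
      exact ⟨.cons (e, !b) rfl (.nil _), rfl, fun x y h =>
        f.liftRel_walkPath_cons h (.refl y (h.target.trans (Path.target _)))⟩
    refine ⟨q.append r, fun e' he' => ?_, fun x y h => ?_⟩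
    · rw [MGraph.Walk.edges_append, hr, List.mem_append, List.mem_singleton] at he'
      rw [MGraph.Walk.edges, List.mem_cons]
      exact he'.symm.imp id (hq e')
    · obtain ⟨z, h1, h2⟩ := LiftRel.trans_split h
      exact f.liftRel_walkPath_append _ _ (hl _ _ h2) (hrl _ _ (f.liftRel_dartPath_flip h1))

/-- An edge path without repeated edges is cut at one of its edges. -/
theorem exists_split_walk {u v : X.V} (p : X.Walk u v) (hp : p.edges.Nodup) {e : X.E}
    (he : e ∈ p.edges) : ∃ (b : Bool) (q : X.Walk u (X.init (e, b))) (r : X.Walk (X.term (e, b)) v),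
      e ∉ q.edges ∧ e ∉ r.edges ∧ ∀ x y, LiftRel (f.walkPath p) x y →
        ∃ x' y', LiftRel (f.walkPath q) x x' ∧ LiftRel (f.dartPath (e, b)) x' y' ∧
          LiftRel (f.walkPath r) y' y := by
  induction p with
  | nil v => cases he
  | cons d h p ih =>
    subst h
    rw [MGraph.Walk.edges, List.nodup_cons] at hp
    by_cases hde : d.1 = e
    · obtain ⟨e', b⟩ := d
      obtain rfl : e' = e := hde
      refine ⟨b, .nil _, p, List.not_mem_nil, hp.1, fun x y h => ?_⟩
      obtain ⟨z, h1, h2⟩ := LiftRel.trans_split h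
      exact ⟨x, z, .refl x (h1.source.trans (Path.source _)), h1, h2⟩
    · rw [MGraph.Walk.edges, List.mem_cons] at he
      obtain ⟨b, q, r, hq, hr, hl⟩ := ih hp.2 (he.resolve_left (Ne.symm hde))
      refine ⟨b, .cons d rfl q, r, ?_, hr, fun x y h => ?_⟩
      · rw [MGraph.Walk.edges, List.mem_cons, not_or]
        exact ⟨Ne.symm hde, hq⟩
      · obtain ⟨z, h1, h2⟩ := LiftRel.trans_split h
        obtain ⟨x', y', h3, h4, h5⟩ := hl _ _ h2
        exact ⟨x', y', f.liftRel_walkPath_cons h1 h3, h4, h5⟩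

end Lifts

section Edges

variable {X : MGraph} {M : Type*} [TopologicalSpace M] (f : GraphMap X M)

/-- Stated for the underlying functions, since the endpoints of the two paths are matched only by a
`cast`; lengths and lifts depend on the functions alone. -/
theorem slide_edge_of_ne {e e' : X.E} (h : e' ≠ e) {w : X.V} (α : X.Walk (X.tgt e) w) :
    (((f.slide e α).edge e' : Path _ _) : I → M) = f.edge e' := by
  simp only [slide, dif_neg h]
  rfl

theorem slide_edge_self (e : X.E) {w : X.V} (α : X.Walk (X.tgt e) w) :
    (((f.slide e α).edge e : Path _ _) : I → M) = (f.edge e).trans (f.walkPath α) := by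
  simp only [slide, dif_pos]
  rfl

theorem subdivide_edge_of_ne {a e : X.E} (h : e ≠ a) (t : I) :
    (((f.subdivide a t).edge (some e) : Path _ _) : I → M) = f.edge e := by
  simp only [subdivide, dif_neg h]
  rfl

theorem subdivide_edge_self (a : X.E) (t : I) :
    (((f.subdivide a t).edge (some a) : Path _ _) : I → M) = (f.edge a).subpath 0 t := by
  simp only [subdivide, dif_pos]
  rfl

theorem subdivide_edge_none (a : X.E) (t : I) :
    (((f.subdivide a t).edge none : Path _ _) : I → M) = (f.edge a).subpath t 1 := rfl

theorem HomotopicFixing.mono {f g : GraphMap X M} {S T : Set X.V} (h : f.HomotopicFixing g T)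
    (hST : S ⊆ T) : f.HomotopicFixing g S := by
  obtain ⟨τ, H, h1, h2, h3⟩ := h
  exact ⟨τ, H, h1, fun v hv => h2 v (hST hv), h3⟩

end Edges

/-! ### Straightening -/

section Straighten

variable {n : ℕ} {Γ : Type*} [Group Γ] [MulAction Γ (HypSpace n)]

/-- Some element of the group moves `x` to `a` and `y` to `b`. -/
def Moved (Γ : Type*) [Group Γ] [MulAction Γ (HypSpace n)] (x y a b : HypSpace n) : Prop :=
  ∃ g : Γ, a = g • x ∧ b = g • y

theorem Moved.of_proj_eq {x a : HypSpace n} (h : proj Γ a = proj Γ x) : Moved Γ x x a a := by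
  obtain ⟨g, hg⟩ := proj_eq_iff.1 h
  exact ⟨g, hg, hg⟩

theorem Moved.self (x y : HypSpace n) : Moved Γ x y x y := ⟨1, by simp, by simp⟩

variable [IsIsometricSMul Γ (HypSpace n)] [ProperlyDiscontinuousSMul Γ (HypSpace n)]
  [IsCancelSMul Γ (HypSpace n)]

/-- Move the lifts of the vertices from `x` to `y`, and make all edges geodesic. -/
theorem exists_straighten {X : MGraph} (f : GraphMap X (HypQuotient n Γ)) (x y : X.V → HypSpace n)
    (hx : ∀ v, proj Γ (x v) = f.vert v) :
    ∃ g : GraphMap X (HypQuotient n Γ), f.HomotopicFixing g {v | y v = x v} ∧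
      ∀ e a b a' b', LiftRel (f.edge e) a b → Moved Γ (x (X.src e)) (y (X.src e)) a a' →
        Moved Γ (x (X.tgt e)) (y (X.tgt e)) b b' → pathLength (g.edge e) ≤ edist a' b' := by
  choose p hp hp0 using fun e => exists_isLift (f.edge e) (hx (X.src e))
  have hp1 : ∀ e, ∃ g : Γ, p e 1 = g • x (X.tgt e) := fun e =>
    proj_eq_iff.1 (((hp e 1).trans (f.edge e).target).trans (hx _).symm)
  choose g1 hg1 using hp1
  have cs : ∀ a b : HypSpace n, Continuous (HypSpace.seg a b) := fun a b =>
    HypSpace.continuous_seg.comp (continuous_const.prodMk (continuous_const.prodMk continuous_id))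
  -- The lift `p e` ends at `g1 e • x (tgt e)`, so the new edge has to end at the same translate of
  -- `y (tgt e)`. The homotopy runs along the segments from `p e t` to `q e t`; by `smul_seg` it
  -- follows the tracks of the vertices at both ends.
  let q : X.E → I → HypSpace n := fun e => HypSpace.seg (y (X.src e)) (g1 e • y (X.tgt e))
  have hq : ∀ e, Continuous (q e) := fun e => cs _ _
  refine ⟨⟨fun v => proj Γ (y v), fun e => ⟨⟨fun t => proj Γ (q e t),
      continuous_proj.comp (hq e)⟩, by simp [q], by simp [q]⟩⟩,
    ⟨fun v => ⟨fun s => proj Γ (HypSpace.seg (x v) (y v) s), continuous_proj.comp (cs _ _)⟩,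
      fun e => ⟨fun z => proj Γ (HypSpace.seg (p e z.2) (q e z.2) z.1),
        continuous_proj.comp (HypSpace.continuous_seg.comp
          (((p e).continuous.comp continuous_snd).prodMk
            (((hq e).comp continuous_snd).prodMk continuous_fst)))⟩, ?_, ?_, ?_⟩, ?_⟩
  · intro v
    simp [hx]
  · intro v hv s
    have hv : y v = x v := hv
    simp only [ContinuousMap.coe_mk, hv, HypSpace.seg_self, hx]
  · refine fun e => ⟨fun t => ⟨?_, ?_⟩, fun s => ⟨?_, ?_⟩⟩
    · simpa using hp e t
    · simp
    · simp [q, hp0]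
    · simp only [ContinuousMap.coe_mk, q, HypSpace.seg_one, hg1, ← HypSpace.smul_seg, proj_smul]
  · rintro e a b a' b' hab ⟨g, ha, ha'⟩ ⟨g', hb, hb'⟩
    obtain ⟨h, h1, h2⟩ := hab.exists_smul_eq (hp e).liftRel
    rw [hp0] at h1
    rw [hg1, smul_smul] at h2
    -- Freeness: the group element that moves the initial lift is the one relating the two lifts of
    -- the edge, and it determines the element at the other end.
    have e1 : g = h := IsCancelSMul.right_cancel _ _ _ (ha.symm.trans h1)
    have e2 : g' = h * g1 e := IsCancelSMul.right_cancel _ _ _ (hb.symm.trans h2)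
    rw [ha', hb', e1, e2, mul_smul, edist_smul_left]
    refine le_trans ?_ (HypSpace.eVariationOn_seg_le _ _)
    exact iInf₂_le (⟨q e, hq e⟩ : C(I, HypSpace n)) fun t => rfl

/-- The result of sliding the end of `ε` along `α`, with the lifts of the vertices moved from `x`
to `y` and all edges made geodesic. -/
theorem exists_slide {X : MGraph} (f : GraphMap X (HypQuotient n Γ)) (x y : X.V → HypSpace n)
    (hx : ∀ v, proj Γ (x v) = f.vert v) (ε : X.E) {w : X.V} (α : X.Walk (X.tgt ε) w) :
    ∃ g : GraphMap (X.retarget ε w) (HypQuotient n Γ),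
      (f.slide ε α).HomotopicFixing g {v | y v = x v} ∧
      (∀ e ≠ ε, ∀ a b a' b', LiftRel (f.edge e) a b →
        Moved Γ (x (X.src e)) (y (X.src e)) a a' → Moved Γ (x (X.tgt e)) (y (X.tgt e)) b b' →
          pathLength (g.edge e) ≤ edist a' b') ∧
      (∀ a b c a' c', LiftRel (f.edge ε) a b → LiftRel (f.walkPath α) b c →
        Moved Γ (x (X.src ε)) (y (X.src ε)) a a' → Moved Γ (x w) (y w) c c' →
          pathLength (g.edge ε) ≤ edist a' c') := by
  obtain ⟨g, hg, hl⟩ := (f.slide ε α).exists_straighten x y hx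
  refine ⟨g, hg, fun e he a b a' b' hab ha hb => ?_, fun a b c a' c' hab hbc ha hc => ?_⟩
  · refine hl e a b a' b' (by rwa [f.slide_edge_of_ne he]) ha ?_
    simp only [MGraph.retarget, if_neg he]
    exact hb
  · refine hl ε a c a' c' (by rw [f.slide_edge_self]; exact hab.trans hbc) ha ?_
    simp only [MGraph.retarget, if_pos]
    exact hc

end Straighten

end GraphMap

/-! ### Length comparisons with the results of edge moves -/

namespace GraphMap

open HypQuotient

section Minimal

variable {n : ℕ} {Γ : Type*} [Group Γ] [MulAction Γ (HypSpace n)]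
  [IsIsometricSMul Γ (HypSpace n)] [ProperlyDiscontinuousSMul Γ (HypSpace n)]
  [IsCancelSMul Γ (HypSpace n)] {X : MGraph} {f : GraphMap X (HypQuotient n Γ)}

/-- A map of minimal length is not longer than the geodesic representatives of the edges that
result from moving the end of an edge to another vertex. -/
theorem IsMinimalRelVertices.length_le_of_slide (hmin : f.IsMinimalRelVertices) {X' : MGraph}
    {f' : GraphMap X' (HypQuotient n Γ)} (hf' : f.IsLoopRefinement X' f') (e : X'.E) {w : X'.V}
    (α : X'.Walk (X'.tgt e) w) (hα : e ∉ α.edges) (L : X'.E → ℝ≥0∞)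
    (hL : ∀ e' ≠ e, ∃ a b, LiftRel (f'.edge e') a b ∧ edist a b ≤ L e')
    (he : ∃ a b c, LiftRel (f'.edge e) a b ∧ LiftRel (f'.walkPath α) b c ∧ edist a c ≤ L e) :
    f.length ≤ ∑' e', L e' := by
  choose x hx using fun v => Quotient.exists_rep (f'.vert v)
  have mv : ∀ (v : X'.V) (a : HypSpace n), proj Γ a = f'.vert v → Moved Γ (x v) (x v) a a :=
    fun v a h => .of_proj_eq (h.trans (hx v).symm)
  -- With `y = x` no vertex moves, as a slide to an existing vertex demands.
  obtain ⟨g, hg, h1, h2⟩ := f'.exists_slide x x hx e α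
  have hmove : f.IsEdgeMove _ g := .toVertex hf' e w α hα g (hg.mono fun v _ => rfl)
  refine (not_lt.1 (hmin _ g hmove)).trans (ENNReal.tsum_le_tsum fun e' => ?_)
  by_cases hee : e' = e
  · rw [hee]
    obtain ⟨a, b, c, hab, hbc, hle⟩ := he
    exact (h2 a b c a c hab hbc (mv _ _ (hab.source.trans (Path.source _)))
      (mv _ _ (hbc.target.trans (Path.target _)))).trans hle
  · obtain ⟨a, b, hab, hle⟩ := hL e' hee
    exact (h1 e' hee a b a b hab (mv _ _ (hab.source.trans (Path.source _)))
      (mv _ _ (hab.target.trans (Path.target _)))).trans hle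

/-- The slide along the empty path straightens all edges at once, and the straightened graph has
finite length. If one edge were longer than its segment, the straightened graph would be strictly
shorter. -/
theorem IsMinimalRelVertices.length_ne_top_and_le [Finite X.E] (hmin : f.IsMinimalRelVertices) :
    f.length ≠ ∞ ∧ ∀ e a b, LiftRel (f.edge e) a b → pathLength (f.edge e) ≤ edist a b := by
  have := Fintype.ofFinite X.E
  choose x hx using fun v => Quotient.exists_rep (f.vert v)
  choose p hp hp0 using fun e => exists_isLift (f.edge e) (hx (X.src e))
  have hfin : ∑' e, edist (p e 0) (p e 1) ≠ ∞ := by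
    rw [tsum_fintype]
    exact (ENNReal.sum_lt_top.2 fun e _ => edist_lt_top _ _).ne
  have hle : ∀ e : X.E, f.length ≤ ∑' e, edist (p e 0) (p e 1) := fun e =>
    hmin.length_le_of_slide .refl e (.nil _) List.not_mem_nil _
      (fun e' _ => ⟨_, _, (hp e').liftRel, le_rfl⟩)
      ⟨_, _, _, (hp e).liftRel, .refl _ ((hp e).liftRel.target.trans (Path.target _)), le_rfl⟩
  refine ⟨?_, fun e a b hab => ?_⟩
  -- A move needs an edge; without edges the length is `0`.
  · rcases isEmpty_or_nonempty X.E with h | ⟨⟨e⟩⟩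
    · simp [length]
    · exact ne_top_of_le_ne_top hfin (hle e)
  · obtain ⟨g, rfl, rfl⟩ := hab.exists_smul_eq (hp e).liftRel
    rw [edist_smul_left]
    by_contra hlt
    exact absurd (hle e) (not_le.2 (ENNReal.tsum_lt_tsum hfin
      (fun e' => (hp e').liftRel.edist_le) (not_le.1 hlt)))

theorem pathLength_pos_of_not_collapses {e : X.E} (he : ¬ f.Collapses e) :
    0 < pathLength (f.edge e) := by
  refine pos_iff_ne_zero.2 fun h => he fun t => ?_
  obtain ⟨x, hx⟩ := Quotient.exists_rep (f.vert (X.src e))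
  obtain ⟨p, hp, hp0⟩ := exists_isLift (f.edge e) hx
  rw [hp.pathLength_eq, eVariationOn.eq_zero_iff] at h
  have := edist_eq_zero.1 (h t trivial 0 trivial)
  rw [← hp t, this, ← (f.edge e).source]
  exact hp 0

theorem IsMinimalRelVertices.ne_of_liftRel [Finite X.E] (hmin : f.IsMinimalRelVertices) {e : X.E}
    (he : ¬ f.Collapses e) {a b : HypSpace n} (h : LiftRel (f.edge e) a b) : a ≠ b := by
  rintro rfl
  have := (pathLength_pos_of_not_collapses he).trans_le (hmin.length_ne_top_and_le.2 e a a h)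
  simp at this

/-! #### Essential cycles -/

omit [IsIsometricSMul Γ (HypSpace n)] [ProperlyDiscontinuousSMul Γ (HypSpace n)]
  [IsCancelSMul Γ (HypSpace n)] in
theorem walkPath_eq_of_collapses {u v : X.V} (p : X.Walk u v)
    (h : ∀ e ∈ p.edges, f.Collapses e) (t : I) : f.walkPath p t = f.vert u := by
  induction p generalizing t with
  | nil v => rfl
  | cons d hd p ih =>
    subst hd
    rw [MGraph.Walk.edges] at h
    have ht : ∀ t, f.dartPath d t = f.vert (X.init d) := by
      obtain ⟨e, b⟩ := d
      have he := h e List.mem_cons_self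
      cases b
      · intro t
        have h1 := he 1
        rw [(f.edge e).target] at h1
        exact (he (unitInterval.symm t)).trans h1.symm
      · exact he
    have h1 := ht 1
    rw [(f.dartPath d).target] at h1
    show ((f.dartPath d).trans (f.walkPath p)) t = _
    rw [Path.trans_apply]
    split_ifs
    · exact ht _
    · exact (ih (fun e he => h e (List.mem_cons_of_mem _ he)) _).trans h1

/-- A null-homotopic cycle has closed lifts. If it crosses `e` once, sliding the end of `e` around
the remainder gives an edge with closed lifts, whose tightened length is `0`. -/
theorem IsMinimalRelVertices.not_homotopic_refl [Finite X.E] (hmin : f.IsMinimalRelVertices)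
    {v : X.V} (c : X.Walk v v) (hc : c.IsSimpleClosed) :
    (∀ t, f.walkPath c t = f.vert v) ∨
      ¬ (f.walkPath c).Homotopic (Path.refl (f.vert v)) := by
  by_cases hcol : ∀ e ∈ c.edges, f.Collapses e
  · exact .inl (f.walkPath_eq_of_collapses c hcol)
  refine .inr fun hhom => ?_
  push Not at hcol
  obtain ⟨e, hec, hne⟩ := hcol
  obtain ⟨b, q, r, hq, hr, hsplit⟩ := f.exists_split_walk c hc.2.1 hec
  obtain ⟨x, hx⟩ := Quotient.exists_rep (f.vert v)
  obtain ⟨p, hp, hp0⟩ := exists_isLift (f.walkPath c) hx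
  have hcl : LiftRel (f.walkPath c) (p 0) (p 0) := by
    have := hp.liftRel
    rwa [← this.eq_of_homotopic_refl hhom] at this
  obtain ⟨y, z, h1, h2, h3⟩ := hsplit _ _ hcl
  have hrq := f.liftRel_walkPath_append r q h3 h1
  have hmem : e ∉ (r.append q).edges := by
    rw [MGraph.Walk.edges_append, List.mem_append, not_or]
    exact ⟨hr, hq⟩
  -- The remainder leads from the end of `e` to its start if the cycle runs along `e`, and must be
  -- reversed if it runs against it.
  obtain ⟨α, hα, a, b, hab, hba⟩ : ∃ α : X.Walk (X.tgt e) (X.src e), e ∉ α.edges ∧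
      ∃ a b, LiftRel (f.edge e) a b ∧ LiftRel (f.walkPath α) b a := by
    cases b
    · obtain ⟨s, hs, hsl⟩ := f.exists_reverse_walk (r.append q)
      exact ⟨s, fun h => hmem (hs e h), z, y, f.liftRel_dartPath_flip h2, hsl _ _ hrq⟩
    · exact ⟨r.append q, hmem, y, z, h2, hrq⟩
  classical
  have hlt : ∑' e', (if e' = e then 0 else pathLength (f.edge e')) < f.length := by
    have hle : ∀ e', (if e' = e then 0 else pathLength (f.edge e')) ≤ pathLength (f.edge e') :=
      fun e' => by split_ifs <;> simp
    refine ENNReal.tsum_lt_tsum (i := e) ?_ hle ?_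
    · exact ne_top_of_le_ne_top hmin.length_ne_top_and_le.1 (ENNReal.tsum_le_tsum hle)
    · simpa using pathLength_pos_of_not_collapses hne
  refine absurd (hmin.length_le_of_slide .refl e α hα _ (fun e' he' => ?_)
    ⟨a, b, a, hab, hba, by simp⟩) (not_le.2 hlt)
  obtain ⟨x', hx'⟩ := Quotient.exists_rep (f.vert (X.src e'))
  obtain ⟨p', hp', -⟩ := exists_isLift (f.edge e') hx'
  exact ⟨_, _, hp'.liftRel, by rw [if_neg he']; exact hp'.liftRel.edist_le⟩

/-! #### Angles -/

omit [IsIsometricSMul Γ (HypSpace n)] [ProperlyDiscontinuousSMul Γ (HypSpace n)]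
  [IsCancelSMul Γ (HypSpace n)] in
-- A one-edge walk with free endpoints, because in a subdivided graph the required endpoints agree
-- with those of the dart only propositionally.
theorem _root_.MGraph.Walk.exists_of_dart {Z : MGraph} (d : Z.Dart) {u w : Z.V}
    (hu : Z.init d = u) (hw : Z.term d = w) : ∃ α : Z.Walk u w, (∀ e ∈ α.edges, e = d.1) ∧
      ∀ (k : GraphMap Z (HypQuotient n Γ)) (x y : HypSpace n), LiftRel (k.dartPath d) x y →
        LiftRel (k.walkPath α) x y := by
  subst hu hw
  exact ⟨.cons d rfl (.nil _), fun e he => List.mem_singleton.1 he, fun k x y h =>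
    k.liftRel_walkPath_cons h (.refl y (h.target.trans (Path.target _)))⟩

/-- A map of minimal length is not longer than the result of replacing the geodesic edges `e` and
`d` with a common endpoint by a tripod. -/
theorem IsMinimalRelVertices.length_le_of_tripod (hmin : f.IsMinimalRelVertices) {X' : MGraph}
    [Finite X'.E] {f' : GraphMap X' (HypQuotient n Γ)} (hf' : f.IsLoopRefinement X' f') {e : X'.E}
    {d : X'.Dart} (hd : d.1 ≠ e) (hinit : X'.init d = X'.tgt e) {a v c w : HypSpace n}
    (he : LiftRel (f'.edge e) a v) (hvc : LiftRel (f'.dartPath d) v c) (L : X'.E → ℝ≥0∞)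
    (hL : ∀ e', e' ≠ e → e' ≠ d.1 → ∃ a b, LiftRel (f'.edge e') a b ∧ edist a b ≤ L e')
    (hw : edist a w + edist v w + edist w c ≤ L e + L d.1) :
    f.length ≤ ∑' e', L e' := by
  classical
  have := Fintype.ofFinite X'.E
  obtain ⟨b, β⟩ := d
  replace hd : b ≠ e := hd
  -- Any interior parameter would do: the new vertex is moved to `w` afterwards.
  let t : I := ⟨1 / 2, by norm_num, by norm_num⟩
  have ht : t ∈ Set.Ioo (0 : I) 1 :=
    ⟨Subtype.coe_lt_coe.1 (by norm_num [t]), Subtype.coe_lt_coe.1 (by norm_num [t])⟩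
  have htgt : (X'.subdivide b).tgt (some e) = some (X'.tgt e) := if_neg hd.symm
  have htb : (X'.subdivide b).tgt (some b) = none := if_pos rfl
  -- The end of `e` is dragged along the half of `b` adjacent to the common vertex: the second half,
  -- backwards, if `d` runs against `b`, and the first half otherwise.
  obtain ⟨α, hα, p, hp, hαp, hle⟩ :
      ∃ α : (X'.subdivide b).Walk ((X'.subdivide b).tgt (some e)) none, some e ∉ α.edges ∧
        ∃ p : C(I, HypSpace n), IsLift p (f'.edge b) ∧
          LiftRel ((f'.subdivide b t).walkPath α) v (p t) ∧
          edist (p 0) w + edist w (p 1) = edist v w + edist w c := by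
    cases β
    · obtain ⟨p, hp, h0, h1⟩ := f'.liftRel_dartPath_flip hvc
      have hp : IsLift p (f'.edge b) := hp
      obtain ⟨α, hα, hl⟩ := MGraph.Walk.exists_of_dart (n := n) (Γ := Γ)
        (Z := X'.subdivide b) (none, false) (u := (X'.subdivide b).tgt (some e)) (w := none)
        (by rw [htgt, ← hinit]; rfl) rfl
      refine ⟨α, fun h => Option.some_ne_none e (hα _ h), p, hp, hl _ _ _ (LiftRel.symm ?_), ?_⟩
      · rw [f'.subdivide_edge_none, ← h1]
        exact LiftRel.subpath hp t 1
      · rw [h0, h1, edist_comm c w, edist_comm w v, add_comm]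
    · obtain ⟨p, hp, h0, h1⟩ := hvc
      have hp : IsLift p (f'.edge b) := hp
      obtain ⟨α, hα, hl⟩ := MGraph.Walk.exists_of_dart (n := n) (Γ := Γ)
        (Z := X'.subdivide b) (some b, true) (u := (X'.subdivide b).tgt (some e)) (w := none)
        (by rw [htgt, ← hinit]; rfl) htb
      refine ⟨α, ?_, p, hp, hl _ _ _ ?_, ?_⟩
      · exact fun h => hd (Option.some.inj (hα _ h)).symm
      · show LiftRel ((f'.subdivide b t).edge (some b)) _ _
        rw [f'.subdivide_edge_self, ← h0]
        exact LiftRel.subpath hp 0 t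
      · rw [h0, h1]
  choose z hz using fun v => Quotient.exists_rep (f'.vert v)
  let x : (X'.subdivide b).V → HypSpace n := fun u => u.elim (p t) z
  let y : (X'.subdivide b).V → HypSpace n := fun u => u.elim w z
  have hx : ∀ u, proj Γ (x u) = (f'.subdivide b t).vert u := by
    rintro (_ | u)
    · exact hp t
    · exact hz u
  have mv : ∀ (u : X'.V) (a : HypSpace n), proj Γ a = f'.vert u →
      Moved Γ (x (some u)) (y (some u)) a a := fun u a h => .of_proj_eq (h.trans (hz u).symm)
  have mn : Moved Γ (x none) (y none) (p t) w := .self _ _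
  obtain ⟨g, hg, h1, h2⟩ := (f'.subdivide b t).exists_slide x y hx (some e) α
  have hmove : f.IsEdgeMove _ g := .toInterior hf' e b hd t ht α hα g (hg.mono (by
    rintro (_ | u) hu
    · exact absurd rfl hu
    · rfl))
  refine (not_lt.1 (hmin _ g hmove)).trans ?_
  -- The legs of the tripod: `e` now ends at `w`, and the two halves of `b` meet there.
  have ge : pathLength (g.edge (some e)) ≤ edist a w := by
    refine h2 a v (p t) a w ?_ hαp (mv _ _ (he.source.trans (Path.source _))) mn
    rw [f'.subdivide_edge_of_ne hd.symm]; exact he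
  have gb : pathLength (g.edge (some b)) ≤ edist (p 0) w := by
    refine h1 (some b) (fun h => hd (Option.some.inj h)) (p 0) (p t) _ _ ?_
      (mv _ _ ((hp 0).trans (Path.source _))) (by rw [htb]; exact mn)
    rw [f'.subdivide_edge_self]; exact LiftRel.subpath hp 0 t
  have gn : pathLength (g.edge none) ≤ edist w (p 1) := by
    refine h1 none (Option.some_ne_none e).symm (p t) (p 1) _ _ ?_ mn (mv _ _ ((hp 1).trans (Path.target _)))
    rw [f'.subdivide_edge_none]; exact LiftRel.subpath hp t 1
  have gr : ∀ e', e' ≠ e → e' ≠ b → pathLength (g.edge (some e')) ≤ L e' := by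
    intro e' hee heb
    obtain ⟨a, c, hac, hle⟩ := hL e' hee heb
    refine (h1 (some e') (fun h => hee (Option.some.inj h)) a c a c ?_
      (mv _ _ (hac.source.trans (Path.source _))) ?_).trans hle
    · rw [f'.subdivide_edge_of_ne heb]; exact hac
    · rw [show (X'.subdivide b).tgt (some e') = some (X'.tgt e') from if_neg heb]
      exact mv _ _ (hac.target.trans (Path.target _))
  have hbe : b ∈ Finset.univ.erase e := Finset.mem_erase.2 ⟨hd, Finset.mem_univ b⟩
  have hsum : g.length = pathLength (g.edge none) + ∑ e' : X'.E, pathLength (g.edge (some e')) :=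
    (tsum_fintype (L := .unconditional (Option X'.E)) _).trans (Fintype.sum_option _)
  rw [hsum, tsum_fintype, ← Finset.add_sum_erase _ _ (Finset.mem_univ e),
    ← Finset.add_sum_erase _ _ hbe, ← Finset.add_sum_erase _ L (Finset.mem_univ e),
    ← Finset.add_sum_erase _ L hbe]
  have hrest : ∑ e' ∈ (Finset.univ.erase e).erase b, pathLength (g.edge (some e')) ≤
      ∑ e' ∈ (Finset.univ.erase e).erase b, L e' := Finset.sum_le_sum fun e' he' => by
    rw [Finset.mem_erase, Finset.mem_erase] at he'
    exact gr e' he'.2.1 he'.1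
  rw [← add_assoc (L e), ← add_assoc (pathLength (g.edge (some e))), ← add_assoc]
  refine add_le_add (le_trans ?_ hw) hrest
  calc _ ≤ edist w (p 1) + (edist a w + edist (p 0) w) := add_le_add gn (add_le_add ge gb)
    _ = edist a w + (edist (p 0) w + edist w (p 1)) := by ring
    _ = _ := by rw [hle]; ring

end Minimal

end GraphMap

theorem tsum_lt_tsum_of_pair {ι : Type*} [Finite ι] {P L : ι → ℝ≥0∞} {i j : ι} (hij : j ≠ i)
    (hL : ∀ k, k ≠ i → k ≠ j → L k ≤ P k) (hlt : L i + L j < P i + P j) (hP : ∑' k, P k ≠ ∞) :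
    ∑' k, L k < ∑' k, P k := by
  classical
  have := Fintype.ofFinite ι
  rw [tsum_fintype] at hP ⊢
  rw [tsum_fintype]
  have hj : j ∈ Finset.univ.erase i := Finset.mem_erase.2 ⟨hij, Finset.mem_univ j⟩
  rw [← Finset.add_sum_erase _ P (Finset.mem_univ i), ← Finset.add_sum_erase _ P hj,
    ← add_assoc] at hP ⊢
  rw [← Finset.add_sum_erase _ L (Finset.mem_univ i), ← Finset.add_sum_erase _ L hj, ← add_assoc]
  have hle : ∑ k ∈ (Finset.univ.erase i).erase j, L k ≤
      ∑ k ∈ (Finset.univ.erase i).erase j, P k := Finset.sum_le_sum fun k hk => by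
    rw [Finset.mem_erase, Finset.mem_erase] at hk
    exact hL k hk.2.1 hk.1
  exact ENNReal.add_lt_add_of_lt_of_le
    (ne_top_of_le_ne_top hP (hle.trans le_add_self)) hlt hle

/-! ### The angle bound and the number of ends at a vertex -/

namespace GraphMap

open HypQuotient

section Minimal

variable {n : ℕ} {Γ : Type*} [Group Γ] [MulAction Γ (HypSpace n)]
  [IsIsometricSMul Γ (HypSpace n)] [ProperlyDiscontinuousSMul Γ (HypSpace n)]
  [IsCancelSMul Γ (HypSpace n)] {X : MGraph} {f : GraphMap X (HypQuotient n Γ)}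

theorem IsMinimalRelVertices.ne_of_liftRel_dartPath [Finite X.E] (hmin : f.IsMinimalRelVertices)
    {d : X.Dart} (hd : ¬ f.Collapses d.1) {a b : HypSpace n} (h : LiftRel (f.dartPath d) a b) :
    b ≠ a := by
  obtain ⟨e, _ | _⟩ := d
  · exact hmin.ne_of_liftRel hd (f.liftRel_dartPath_flip h)
  · exact (hmin.ne_of_liftRel hd h).symm

theorem IsMinimalRelVertices.angle_of_edge_ne [Finite X.E] (hmin : f.IsMinimalRelVertices)
    {d₁ d₂ : X.Dart} (hne : d₂.1 ≠ d₁.1) (hinit : X.init d₁ = X.init d₂)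
    (h₁ : ¬ f.Collapses d₁.1) (h₂ : ¬ f.Collapses d₂.1) {v a c : HypSpace n}
    (ha : LiftRel (f.dartPath d₁) v a) (hc : LiftRel (f.dartPath d₂) v c) :
    2 * Real.pi / 3 ≤ HypSpace.angle v a c := by
  classical
  by_contra hlt
  obtain ⟨w, hw⟩ := HypSpace.exists_edist_tripod_lt (hmin.ne_of_liftRel_dartPath h₁ ha)
    (hmin.ne_of_liftRel_dartPath h₂ hc) (not_le.1 hlt)
  have hle : ∀ {d : X.Dart} {x y : HypSpace n}, LiftRel (f.dartPath d) x y →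
      edist x y ≤ pathLength (f.edge d.1) := by
    rintro ⟨e, _ | _⟩ x y h
    · rw [edist_comm]
      exact (f.liftRel_dartPath_flip h).edist_le
    · exact LiftRel.edist_le h
  obtain ⟨e, b⟩ := d₁
  -- Only the sum of the two bounds matters, so the whole tripod is charged to `e`.
  set L : X.E → ℝ≥0∞ := fun e' => if e' = e then edist a w + edist v w + edist w c else
    if e' = d₂.1 then 0 else pathLength (f.edge e') with hL
  have hLe : L e = edist a w + edist v w + edist w c := if_pos rfl
  have hLd : L d₂.1 = 0 := (if_neg hne).trans (if_pos rfl)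
  have hLo : ∀ e', e' ≠ e → e' ≠ d₂.1 → L e' = pathLength (f.edge e') := fun e' h h' =>
    (if_neg h).trans (if_neg h')
  have hlen : ∑' e', L e' < f.length := by
    refine tsum_lt_tsum_of_pair hne (fun e' h h' => (hLo e' h h').le) ?_
      hmin.length_ne_top_and_le.1
    rw [hLe, hLd, add_zero]
    refine hw.trans_le (add_le_add ?_ (hle hc))
    rw [edist_comm]
    exact hle ha
  have hother : ∀ e', e' ≠ e → e' ≠ d₂.1 →
      ∃ x y, LiftRel (f.edge e') x y ∧ edist x y ≤ L e' := fun e' h h' => by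
    obtain ⟨x, hx⟩ := Quotient.exists_rep (f.vert (X.src e'))
    obtain ⟨p, hp, -⟩ := exists_isLift (f.edge e') hx
    exact ⟨_, _, hp.liftRel, by rw [hLo e' h h']; exact hp.liftRel.edist_le⟩
  refine absurd ?_ (not_le.2 hlen)
  cases b
  · exact hmin.length_le_of_tripod .refl (d := d₂) hne hinit.symm (f.liftRel_dartPath_flip ha) hc L
      hother (by rw [hLe, hLd, add_zero])
  -- The tripod lemma slides the terminal end of an edge. Here the end in question is the initial
  -- one, so all orientations are reversed.
  · have : Finite X.reverse.E := ‹Finite X.E›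
    refine hmin.length_le_of_tripod (.reverse .refl) (e := e) (d := (d₂.1, !d₂.2)) hne ?_
      (LiftRel.symm ha) (c := c) (w := w) ?_ L (fun e' h h' => ?_) (by rw [hLe, hLd, add_zero])
    · obtain ⟨b, _ | _⟩ := d₂ <;> exact hinit.symm
    · obtain ⟨b, _ | _⟩ := d₂
      · exact hc
      · exact LiftRel.symm (LiftRel.symm hc)
    · obtain ⟨x, y, hxy, hle⟩ := hother e' h h'
      exact ⟨y, x, LiftRel.symm hxy, by rwa [edist_comm]⟩

/-- One end of a loop cannot slide along the loop itself. After cutting it at its midpoint, the two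
halves are different edges with the same directions at `v`, and they are together as long as the
loop. -/
theorem IsMinimalRelVertices.angle_of_loop [Finite X.E] (hmin : f.IsMinimalRelVertices) {e : X.E}
    (hloop : X.src e = X.tgt e) (he : ¬ f.Collapses e) {v a c : HypSpace n}
    (ha : LiftRel (f.edge e) v a) (hc : LiftRel (f.edge e) c v) :
    2 * Real.pi / 3 ≤ HypSpace.angle v c a := by
  classical
  by_contra hlt
  rw [not_le] at hlt
  have := Fintype.ofFinite X.E
  have hva := hmin.ne_of_liftRel he ha
  obtain ⟨p, hp, rfl, rfl⟩ := ha
  obtain ⟨q, hq, rfl, hq1⟩ := hc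
  have hvp : eVariationOn p Set.univ ≤ edist (p 0) (p 1) := by
    rw [← hp.pathLength_eq]; exact hmin.length_ne_top_and_le.2 e _ _ hp.liftRel
  have hvq : eVariationOn q Set.univ ≤ edist (q 0) (q 1) := by
    rw [← hq.pathLength_eq]; exact hmin.length_ne_top_and_le.2 e _ _ hq.liftRel
  have hL : 0 < dist (p 0) (p 1) := dist_pos.2 hva
  -- The edge may pause near its ends, so the cut is placed by distance: `p t` must differ from both
  -- endpoints.
  obtain ⟨t, ht⟩ : ∃ t, dist (p 0) (p t) = dist (p 0) (p 1) / 2 := by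
    have hcont : Continuous fun t => dist (p 0) (p t) := by fun_prop
    have := intermediate_value_Icc (zero_le_one' I) hcont.continuousOn
    obtain ⟨t, -, ht⟩ := this (a := dist (p 0) (p 1) / 2)
      ⟨by rw [dist_self]; linarith, by linarith⟩
    exact ⟨t, ht⟩
  have hpt := (HypSpace.dist_eq_sub_of_eVariationOn_le hvp (le_refl t)).2
  have hqt := (HypSpace.dist_eq_sub_of_eVariationOn_le hvq (le_refl t)).2
  have ht0 : t ≠ 0 := by rintro rfl; rw [dist_self] at ht; linarith
  have ht1 : t ≠ 1 := by rintro rfl; linarith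
  have htI : t ∈ Set.Ioo (0 : I) 1 :=
    ⟨lt_of_le_of_ne unitInterval.nonneg' ht0.symm, lt_of_le_of_ne unitInterval.le_one' ht1⟩
  obtain ⟨g, hg⟩ := hq.exists_smul_eq hp
  have hqd : dist (q t) (p 0) = dist (p t) (p 1) := by rw [← hq1, hg, hg, dist_smul]
  have hmp : p t ≠ p 0 := fun h => by rw [h, dist_self] at ht; linarith
  have hmq : q t ≠ p 0 := fun h => by rw [h, dist_self] at hqd; linarith
  have hang : HypSpace.angle (p 0) (q t) (p t) < 2 * Real.pi / 3 := by
    rw [HypSpace.angle_eq_arccos] at hlt ⊢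
    rwa [HypSpace.unitDirection_eq_of_dist_add hmp hpt,
      HypSpace.unitDirection_eq_of_dist_add (q := q 0) hmq (by
        rw [← hq1, dist_comm (q 1) (q t), dist_comm (q t) (q 0), dist_comm (q 1) (q 0), add_comm]; exact hqt)]
  obtain ⟨w, hw⟩ := HypSpace.exists_edist_tripod_lt hmq hmp hang
  set K := edist (q t) w + edist (p 0) w + edist w (p t) with hK
  have hKe : K < pathLength (f.edge e) := by
    refine lt_of_lt_of_le hw (le_trans (le_of_eq ?_) hp.liftRel.edist_le)
    rw [edist_dist, edist_dist, edist_dist, hqd, ← ENNReal.ofReal_add dist_nonneg dist_nonneg,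
      add_comm, hpt]
  have : Finite (X.subdivide e).E := inferInstanceAs (Finite (Option X.E))
  -- The tripod is charged to the first half of the loop, and nothing to the second.
  let L : (X.subdivide e).E → ℝ≥0∞ := fun o =>
    o.elim 0 fun e' => if e' = e then K else pathLength (f.edge e')
  have hle : f.length ≤ ∑' o, L o := by
    refine hmin.length_le_of_tripod (.subdivide .refl e hloop t htI) (e := none)
      (d := (some e, true)) (Option.some_ne_none e) (congrArg some hloop) (a := q t) (v := p 0)
      (c := p t) (w := w) ?_ ?_ L ?_ ?_
    · rw [f.subdivide_edge_none, ← hq1]; exact LiftRel.subpath hq t 1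
    · show LiftRel ((f.subdivide e t).edge (some e)) _ _
      rw [f.subdivide_edge_self]; exact LiftRel.subpath hp 0 t
    · rintro (_ | e') h h'
      · exact absurd rfl h
      · have hee : e' ≠ e := fun h => h' (congrArg some h)
        obtain ⟨x, hx⟩ := Quotient.exists_rep (f.vert (X.src e'))
        obtain ⟨r, hr, -⟩ := exists_isLift (f.edge e') hx
        refine ⟨r 0, r 1, by rw [f.subdivide_edge_of_ne hee]; exact hr.liftRel, ?_⟩
        refine hr.liftRel.edist_le.trans (le_of_eq ?_)
        exact (if_neg hee).symm
    · refine le_of_eq (Eq.trans ?_ (zero_add _).symm)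
      exact (if_pos rfl).symm
  have hsum : ∑' o, L o = ∑' e' : X.E, if e' = e then K else pathLength (f.edge e') := by
    refine (tsum_fintype (L := .unconditional (Option X.E)) _).trans
      ((Fintype.sum_option _).trans ?_)
    rw [tsum_fintype]
    exact zero_add _
  have hPL : ∀ e', (if e' = e then K else pathLength (f.edge e')) ≤ pathLength (f.edge e') := by
    intro e'
    split_ifs with h
    · rw [h]; exact hKe.le
    · exact le_rfl
  rw [hsum] at hle
  refine absurd hle (not_le.2 (ENNReal.tsum_lt_tsum (i := e) ?_ hPL (by simpa using hKe)))
  exact ne_top_of_le_ne_top hmin.length_ne_top_and_le.1 (ENNReal.tsum_le_tsum hPL)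

theorem IsMinimalRelVertices.angle_le [Finite X.E] (hmin : f.IsMinimalRelVertices)
    {d₁ d₂ : X.Dart} (hne : d₁ ≠ d₂) (hinit : X.init d₁ = X.init d₂)
    (h₁ : ¬ f.Collapses d₁.1) (h₂ : ¬ f.Collapses d₂.1) {v a c : HypSpace n}
    (ha : LiftRel (f.dartPath d₁) v a) (hc : LiftRel (f.dartPath d₂) v c) :
    2 * Real.pi / 3 ≤ HypSpace.angle v a c := by
  by_cases hd : d₂.1 = d₁.1
  · obtain ⟨e, b⟩ := d₁
    obtain ⟨e', b'⟩ := d₂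
    obtain rfl : e' = e := hd
    cases b <;> cases b'
    · exact absurd rfl hne
    · exact hmin.angle_of_loop hinit.symm h₁ hc (f.liftRel_dartPath_flip ha)
    · rw [HypSpace.angle_comm]
      exact hmin.angle_of_loop hinit h₁ ha (f.liftRel_dartPath_flip hc)
    · exact absurd rfl hne
  · exact hmin.angle_of_edge_ne hd hinit h₁ h₂ ha hc

theorem IsMinimalRelVertices.encard_le_three [Finite X.E] (hmin : f.IsMinimalRelVertices)
    (v : X.V) : {d : X.Dart | X.init d = v ∧ ¬ f.Collapses d.1}.encard ≤ 3 := by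
  obtain ⟨x, hx⟩ := Quotient.exists_rep (f.vert v)
  -- All ends at `v` are lifted from the same point `x`; other darts get the default value `x`.
  have hlift : ∀ d : X.Dart, ∃ a, X.init d = v → LiftRel (f.dartPath d) x a := fun d => by
    by_cases h : X.init d = v
    · subst h
      obtain ⟨p, hp, rfl⟩ := exists_isLift (f.dartPath d) hx
      exact ⟨p 1, fun _ => hp.liftRel⟩
    · exact ⟨x, fun h' => absurd h' h⟩
  choose a ha using hlift
  have hfin := Set.toFinite {d : X.Dart | X.init d = v ∧ ¬ f.Collapses d.1}
  rw [hfin.encard_eq_coe_toFinset_card]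
  refine Nat.cast_le.2 (HypSpace.card_le_three_of_angle x _ a (fun d hd => ?_)
    fun d hd d' hd' hne => ?_)
  · obtain ⟨h1, h2⟩ := hfin.mem_toFinset.1 hd
    exact hmin.ne_of_liftRel_dartPath h2 (ha d h1)
  · obtain ⟨h1, h2⟩ := hfin.mem_toFinset.1 hd
    obtain ⟨h1', h2'⟩ := hfin.mem_toFinset.1 hd'
    exact hmin.angle_le hne (h1.trans h1'.symm) h2 h2' (ha d h1) (ha d' h1')

end Minimal

end GraphMap

theorem mainTheorem9 {n : ℕ} {Γ : Type*} [Group Γ] [MulAction Γ (HypSpace n)]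
    [IsIsometricSMul Γ (HypSpace n)] [ProperlyDiscontinuousSMul Γ (HypSpace n)]
    [IsCancelSMul Γ (HypSpace n)]
    (X : MGraph) [Finite X.V] [Finite X.E]
    (f : GraphMap X (HypQuotient n Γ)) (hcarrier : f.IsCarrier)
    (hmin : f.IsMinimalRelVertices) :
    -- at most three ends of non-collapsed edges meet at a vertex
    (∀ v : X.V, {d : X.Dart | X.init d = v ∧ ¬ f.Collapses d.1}.encard ≤ 3) ∧
    -- in particular the graph is at most trivalent if no edge is collapsed
    ((∀ e, ¬ f.Collapses e) → ∀ v : X.V, {d : X.Dart | X.init d = v}.encard ≤ 3) ∧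
    -- edges are geodesic
    (∀ e, IsGeodesicSegment (f.edge e)) ∧
    -- angles, measured between lifts that start at the same point
    (∀ d₁ d₂ : X.Dart, d₁ ≠ d₂ → X.init d₁ = X.init d₂ →
      ¬ f.Collapses d₁.1 → ¬ f.Collapses d₂.1 →
      ∀ p₁ p₂ : C(unitInterval, HypSpace n), IsLift p₁ (f.dartPath d₁) → IsLift p₂ (f.dartPath d₂) →
        p₁ 0 = p₂ 0 → 2 * Real.pi / 3 ≤ HypSpace.angle (p₁ 0) (p₁ 1) (p₂ 1)) ∧
    -- simple closed paths
    (∀ (v : X.V) (c : X.Walk v v), c.IsSimpleClosed →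
      (∀ t, f.walkPath c t = f.vert v) ∨
        ¬ (f.walkPath c).Homotopic (Path.refl (f.vert v))) := by
  refine ⟨hmin.encard_le_three, fun h v => ?_, fun e => ?_, ?_,
    fun v c hc => hmin.not_homotopic_refl c hc⟩
  · simpa [h] using hmin.encard_le_three v
  · obtain ⟨x, hx⟩ := Quotient.exists_rep (f.vert (X.src e))
    obtain ⟨p, hp, -⟩ := exists_isLift (f.edge e) hx
    exact hp.isGeodesicSegment (hmin.length_ne_top_and_le.2 e _ _ hp.liftRel)
  · intro d₁ d₂ hne hinit h₁ h₂ p₁ p₂ hp₁ hp₂ h0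
    exact hmin.angle_le hne hinit h₁ h₂ hp₁.liftRel (by rw [h0]; exact hp₂.liftRel)
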